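/- Setting. Let $U=[d]$ with $d=d(n)$, and let $w_q,w_u,w_1$ (which may depend on $n$) satisfy $w_q,w_u\in[0,1]$, $0<w_qw_u<w_1\le\min\{w_q,w_u\}$, with $w_qd,\ w_ud,\ w_1d$ integers. A list-of-points data structure with $m=m(n)$ lists consists of jointly random sets $A_1,\dots,A_m\subseteq\{0,1\}^d$ and random index sets $I(q)\subseteq[m]$ for every $q\in\{0,1\}^d$, whose distribution does not depend on the dataset. On a dataset $P$ it stores the lists $L_i=P\cap A_i$ (points counted with multiplicity); its space is $m+\sum_{i\in[m]}|L_i|$ and its time on a query $q$ is $|I(q)|+\sum_{i\in I(q)}|L_i|$; it succeeds for $q$ and $y\in P$ if $y\in L_i$ for some $i\in I(q)$. It solves the $(w_q,w_u,w_1,w_qw_u)$-GapSS problem with probability $0.99$ if for every dataset $P$ of $n$ sets of size $w_ud$, every query $q$ with $|q|=w_qd$ and every $y\in P$ with $|q\cap y|\ge w_1d$, it succeeds for $q$ and $y$ with probability at least $0.99$. A random instance consists of a uniformly random pair $(q,y)$ with $|q|=w_qd$, $|y|=w_ud$, $|q\cap y|=w_1d$, and of $n-1$ further independent uniformly random sets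 of size $w_ud$; the dataset is $y$ together with these $n-1$ sets, and $q$ is the query. For probability distributions $T\ll P$ on a finite set let $D(T\|P)=\sum T\log(T/P)$ (with $0\log 0=0$), and let $d(t\|w)=t\log\frac tw+(1-t)\log\frac{1-t}{1-w}$. Theorem. Suppose that $w_qw_ud=\omega(\log n)$ and that, for all large $n$, a list-of-points data structure solves the $(w_q,w_u,w_1,w_qw_u)$-GapSS problem for $n$ points with probability $0.99$ and, on the random instance, uses expected space at most $n^{1+\rho_u}$ and expected query time at most $n^{\rho_q-o(1)}$ (where $\rho_q,\rho_u$ may depend on $n$). Then for every $\alpha\in[0,1]$, $$\alpha\rho_q+(1-\alpha)\rho_u\ \ge\ \inf_{\substack{t_q,t_u\in[0,1]\\ t_u\ne w_u}}\left(\alpha\,\frac{D(T\|P)-d(t_q\|w_q)}{d(t_u\|w_u)}+(1-\alpha)\,\frac{D(T\|P)-d(t_u\|w_u)}{d(t_u\|w_u)}\right)-o(1)\qquad(n\to\infty),$$ where $P=\begin{pmatrix}w_1&w_q-w_1\\w_u-w_1&1-w_q-w_u+w_1\end{pmatrix}$ is the distribution of $X\in\{0,1\}^2$ whose four entries are the probabilities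 of $(1,1),(1,0),(0,1),(0,0)$, and $T$ minimizes $D(T\|P)$ among the distributions $T\ll P$ with $E_{X\sim T}[X]=(t_q,t_u)$ (pairs $(t_q,t_u)$ for which no such $T$ exists, i.e. $D(T\|P)=\infty$, are left out of the infimum). In particular, if $w_q,w_u,w_1,\rho_q,\rho_u$ are constants, the inequality holds without the $-o(1)$ term. -/

import Mathlib

open Filter Topology Finset

/-! ### List-of-points data structures

Sets over a universe of size `d` are `Finset (Fin d)`, i.e. points of the cube `{0,1}^d`. -/

/-- One outcome of the random choices of a list-of-points data structure with `m` lists: the sets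
`A i` of points and, for every possible query `q`, the set `I q` of indices of lists to scan.
Neither depends on the dataset. -/
structure ListOfPoints (d m : ℕ) where
  A : Fin m → Finset (Finset (Fin d))
  I : Finset (Fin d) → Finset (Fin m)

namespace ListOfPoints

variable {d m : ℕ}

def equivProd (d m : ℕ) : ListOfPoints d m ≃
    (Fin m → Finset (Finset (Fin d))) × (Finset (Fin d) → Finset (Fin m)) where
  toFun D := (D.A, D.I)
  invFun p := ⟨p.1, p.2⟩
  left_inv _ := rfl
  right_inv _ := rfl

instance (d m : ℕ) : Fintype (ListOfPoints d m) := Fintype.ofEquiv _ (equivProd d m).symm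

/-- The list `L i = P ∩ A i` maintained for the dataset `P` (a collection of points, repetitions
counted). -/
def lists (D : ListOfPoints d m) (P : Multiset (Finset (Fin d))) (i : Fin m) :
    Multiset (Finset (Fin d)) :=
  P.filter (fun y => y ∈ D.A i)

/-- Total space `m + ∑ i, |L i|`. -/
def space (D : ListOfPoints d m) (P : Multiset (Finset (Fin d))) : ℕ :=
  m + ∑ i, (D.lists P i).card

/-- Query time `|I q| + ∑ i ∈ I q, |L i|`. -/
def queryTime (D : ListOfPoints d m) (P : Multiset (Finset (Fin d))) (q : Finset (Fin d)) : ℕ :=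
  (D.I q).card + ∑ i ∈ D.I q, (D.lists P i).card

/-- The query `q` succeeds for the point `y` of the dataset `P`: a scanned list contains `y`. -/
def Succeeds (D : ListOfPoints d m) (P : Multiset (Finset (Fin d))) (q y : Finset (Fin d)) :
    Prop :=
  ∃ i ∈ D.I q, y ∈ D.lists P i

end ListOfPoints

/-- Expectation of `f` under a probability distribution on a finite type. -/
noncomputable def pmfExp {α : Type} [Fintype α] (p : PMF α) (f : α → ℝ) : ℝ :=
  ∑ a, (p a).toReal * f a

/-- Probability of the event `E` under a probability distribution on a finite type. -/
noncomputable def pmfProb {α : Type} [Fintype α] (p : PMF α) (E : Set α) : ℝ :=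
  pmfExp p (E.indicator fun _ => 1)

/-! ### GapSS and its random instances -/

/-- A random data structure `p` solves similarity search with success probability at least `γ`:
for every dataset `P` of `n` sets of size `ku`, every query `q` of size `kq`, and every `y` in `P`
with `|q ∩ y| ≥ k₁`, it succeeds with probability at least `γ`. -/
def SolvesGapSS {d m : ℕ} (p : PMF (ListOfPoints d m)) (n kq ku k₁ : ℕ) (γ : ℝ) : Prop :=
  ∀ (P : Multiset (Finset (Fin d))) (q : Finset (Fin d)),
    P.card = n → (∀ z ∈ P, z.card = ku) → q.card = kq →
    ∀ y ∈ P, k₁ ≤ (q ∩ y).card → γ ≤ pmfProb p {D | D.Succeeds P q y}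

/-- The outcomes `(q, y, Y)` of a random instance: a planted pair `(q, y)` with `|q| = kq`,
`|y| = ku`, `|q ∩ y| = k₁`, and `n - 1` further sets `Y j` of size `ku`. The uniform distribution
on this set makes the planted pair uniform and the `Y j` uniform, all of them independent. -/
def randomInstances (n d kq ku k₁ : ℕ) :
    Finset (Finset (Fin d) × Finset (Fin d) × (Fin (n - 1) → Finset (Fin d))) :=
  univ.filter fun x =>
    x.1.card = kq ∧ x.2.1.card = ku ∧ (x.1 ∩ x.2.1).card = k₁ ∧ ∀ j, (x.2.2 j).card = ku

/-- The dataset of an instance `(q, y, Y)`: the planted set `y` and the `n - 1` sets `Y j`. -/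
def instanceDataset {n d : ℕ}
    (x : Finset (Fin d) × Finset (Fin d) × (Fin (n - 1) → Finset (Fin d))) :
    Multiset (Finset (Fin d)) :=
  x.2.1 ::ₘ (univ : Finset (Fin (n - 1))).val.map x.2.2

/-- Expected space, over the data structure and the random instance. -/
noncomputable def expectedSpace {d m : ℕ} (p : PMF (ListOfPoints d m)) (n kq ku k₁ : ℕ) : ℝ :=
  pmfExp p fun D =>
    (∑ x ∈ randomInstances n d kq ku k₁, (D.space (instanceDataset x) : ℝ)) /
      (randomInstances n d kq ku k₁).card

/-- Expected query time, over the data structure and the random instance. -/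
noncomputable def expectedQueryTime {d m : ℕ} (p : PMF (ListOfPoints d m))
    (n kq ku k₁ : ℕ) : ℝ :=
  pmfExp p fun D =>
    (∑ x ∈ randomInstances n d kq ku k₁, (D.queryTime (instanceDataset x) x.1 : ℝ)) /
      (randomInstances n d kq ku k₁).card

/-! ### Divergences

A distribution on `{0,1}²` is a `2 × 2` matrix whose entry `(j, k)` is the probability of the
outcome `(1 - j, 1 - k)`. -/

/-- `P = [w₁, wq - w₁; wu - w₁, 1 - wq - wu + w₁]`. -/
def pairDist (wq wu w₁ : ℝ) : Matrix (Fin 2) (Fin 2) ℝ :=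
  !![w₁, wq - w₁; wu - w₁, 1 - wq - wu + w₁]

/-- `D(T ‖ P) = ∑ T log (T / P)`, for `T ≪ P`, with `0 log 0 = 0`. -/
noncomputable def klMatrix (T P : Matrix (Fin 2) (Fin 2) ℝ) : ℝ :=
  ∑ j, ∑ k, T j k * Real.log (T j k / P j k)

/-- Binary divergence `d(t ‖ w)`, for `0 < w < 1`. -/
noncomputable def klBinary (t w : ℝ) : ℝ :=
  t * Real.log (t / w) + (1 - t) * Real.log ((1 - t) / (1 - w))

/-- `T` is a probability distribution on `{0,1}²`, `T ≪ P`, and `E_{X ∼ T}[X] = (tq, tu)`. -/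
def Feasible (P : Matrix (Fin 2) (Fin 2) ℝ) (tq tu : ℝ) (T : Matrix (Fin 2) (Fin 2) ℝ) : Prop :=
  (∀ j k, 0 ≤ T j k) ∧ ∑ j, ∑ k, T j k = 1 ∧ (∀ j k, P j k = 0 → T j k = 0) ∧
    T 0 0 + T 0 1 = tq ∧ T 0 0 + T 1 0 = tu

/-- `T` attains the infimum of `D(T ‖ P)` over the feasible distributions for `(tq, tu)`. -/
def IsArgInf (P : Matrix (Fin 2) (Fin 2) ℝ) (tq tu : ℝ) (T : Matrix (Fin 2) (Fin 2) ℝ) : Prop :=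
  Feasible P tq tu T ∧ ∀ T', Feasible P tq tu T' → klMatrix T P ≤ klMatrix T' P

/-- The values of the trade-off expression; pairs `(tq, tu)` with no `T ≪ P` of that expectation
(infinite divergence) contribute nothing. -/
def tradeoffValues (α wq wu w₁ : ℝ) : Set ℝ :=
  {v | ∃ tq ∈ Set.Icc (0 : ℝ) 1, ∃ tu ∈ Set.Icc (0 : ℝ) 1, tu ≠ wu ∧
    ∃ T, IsArgInf (pairDist wq wu w₁) tq tu T ∧
      v = α * ((klMatrix T (pairDist wq wu w₁) - klBinary tq wq) / klBinary tu wu) +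
        (1 - α) * ((klMatrix T (pairDist wq wu w₁) - klBinary tu wu) / klBinary tu wu)}

/-- The infimum over `tq, tu ∈ [0,1]`, `tu ≠ wu`, of the trade-off expression. -/
noncomputable def tradeoffInf (α wq wu w₁ : ℝ) : ℝ :=
  sInf (tradeoffValues α wq wu w₁)

/-!
The proof compares a uniformly random close pair `(q, y)` with a pair of random sets with
independent coordinates of distribution `P`, for which the trade-off infimum `lam` turns into a
two-function inequality.

*Entropy and functions.* By definition of the infimum (and since a minimizing `T` exists by
compactness), `D(T‖P) ≥ α d(t_q‖w_q) + β d(t_u‖w_u)` for all `T ≪ P`, where `β = 1 - α + lam`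
lies in `[0, 1]` (`GapParams.klMatrix_ge`). By Gibbs' variational principle this gives
`E_P[F^α G^β] ≤ (E F)^α (E G)^β` for functions on `{0,1}` (`pair_ineq`), an inequality that
tensorizes to `d` coordinates (`pair_ineq_pi`). Applied to the indicators of scanning and storing
in one list, of probabilities `b` and `a`, it bounds the chance that the list serves a pair by
`b^α a^β`. Summing over the lists and comparing `b^α a^β` with the costs `b (1 + n a)` and
`1 + n a` gives the trade-off (`tradeoff_of_closeWord`).

*From independent coordinates to fixed sizes.* Conditioning on the sizes would lose a factor
polynomial in `d`, which need not be `n^{o(1)}`. Instead the size of each of the two sets is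
corrected by adding or removing uniformly random elements, using no information about the other
set. The corrected sets are uniform of the right sizes (`sum_nearAvg`), and functions of the
corrected set become functions of the original one, so that nothing is lost in the inequality. As
the data structure must succeed on every pair with intersection at least `k₁`, it suffices that
the corrected pair has such an intersection with probability bounded below
(`prodProb_closeWord`). Writing `K, A, B, C` for `k₁, kq - k₁, ku - k₁` and the size of the
complement of the union, this holds as soon as the larger of `A` and `B` is large and not much
smaller than the smaller of `K` and `C`: shift the expected cell sizes by some standard deviations
in a favourable direction, use Chernoff's bound for the shifted distribution, and return to `P` by
the Cauchy–Schwarz inequality, at the cost of a constant factor (`prodProb_ge_of_shift`).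

*The remaining parameters.* If this condition fails, then `lam` is small, as is seen by testing the
infimum with point masses at `(1, 1)` and `(0, 0)` (`tradeoffInf_le_or_closeWord`), and it suffices
that neither exponent is substantially negative (`exponents_nonneg`).
-/


/-! ### Inequalities between divergences -/

lemma sub_le_mul_log_div {t p : ℝ} (ht : 0 ≤ t) (hp : 0 ≤ p) (h : p = 0 → t = 0) :
    t - p ≤ t * Real.log (t / p) := by
  rcases ht.eq_or_lt with rfl | ht
  · simpa using hp
  have hp' : 0 < p := lt_of_le_of_ne hp fun h0 => ht.ne' (h h0.symm)
  have h1 := Real.log_le_sub_one_of_pos (div_pos hp' ht)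
  rw [← inv_div, Real.log_inv]
  have h2 : t * Real.log (p / t) ≤ t * (p / t - 1) := by gcongr
  have h3 : t * (p / t - 1) = p - t := by field_simp
  linarith

lemma sub_lt_mul_log_div {t p : ℝ} (ht : 0 ≤ t) (hp : 0 < p) (h : t ≠ p) :
    t - p < t * Real.log (t / p) := by
  rcases ht.eq_or_lt with rfl | ht
  · simpa using hp
  have h1 := Real.log_lt_sub_one_of_pos (div_pos hp ht)
    (fun h0 => h ((div_eq_one_iff_eq ht.ne').1 h0).symm)
  rw [← inv_div, Real.log_inv]
  have h2 : t * Real.log (p / t) < t * (p / t - 1) := by gcongr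
  have h3 : t * (p / t - 1) = p - t := by field_simp
  linarith

lemma klBinary_pos {t w : ℝ} (ht : t ∈ Set.Icc (0 : ℝ) 1) (hw : w ∈ Set.Ioo (0 : ℝ) 1)
    (h : t ≠ w) : 0 < klBinary t w := by
  have h1 := sub_lt_mul_log_div ht.1 hw.1 h
  have h2 := sub_lt_mul_log_div (t := 1 - t) (p := 1 - w) (by linarith [ht.2])
    (by linarith [hw.2]) (fun h0 => h (by linarith))
  unfold klBinary
  linarith

lemma klBinary_self {w : ℝ} (hw : w ∈ Set.Ioo (0 : ℝ) 1) : klBinary w w = 0 := by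
  rw [klBinary, div_self hw.1.ne', div_self (sub_pos.2 hw.2).ne', Real.log_one]
  ring

lemma klBinary_nonneg {t w : ℝ} (ht : t ∈ Set.Icc (0 : ℝ) 1) (hw : w ∈ Set.Ioo (0 : ℝ) 1) :
    0 ≤ klBinary t w := by
  by_cases h : t = w
  · rw [h, klBinary_self hw]
  · exact (klBinary_pos ht hw h).le

/-- The log-sum inequality for two summands. -/
lemma log_sum_le {s t p r : ℝ} (hs : 0 ≤ s) (ht : 0 ≤ t) (hp : 0 ≤ p) (hr : 0 ≤ r)
    (hps : p = 0 → s = 0) (hrt : r = 0 → t = 0) :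
    (s + t) * Real.log ((s + t) / (p + r)) ≤ s * Real.log (s / p) + t * Real.log (t / r) := by
  rcases (add_nonneg hs ht).eq_or_lt with h0 | h0
  · have hs0 : s = 0 := by linarith
    have ht0 : t = 0 := by linarith
    simp [hs0, ht0]
  have hpr : 0 < p + r := by
    refine lt_of_le_of_ne (add_nonneg hp hr) fun h1 => ?_
    have := hps (by linarith)
    have := hrt (by linarith)
    linarith
  set c := (s + t) / (p + r) with hc
  have hc0 : 0 < c := div_pos h0 hpr
  have key : ∀ {u v : ℝ}, 0 ≤ u → 0 ≤ v → (v = 0 → u = 0) →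
      u - v * c ≤ u * Real.log (u / v) - u * Real.log c := by
    intro u v hu hv h
    have h1 := sub_le_mul_log_div hu (mul_nonneg hv hc0.le)
      (fun h2 => h ((mul_eq_zero.1 h2).resolve_right hc0.ne'))
    rcases hu.eq_or_lt with rfl | hu
    · simpa using h1
    have hv0 : v ≠ 0 := fun h2 => hu.ne' (h h2)
    rw [← div_div, Real.log_div (div_ne_zero hu.ne' hv0) hc0.ne'] at h1
    linarith
  have h1 := key hs hp hps
  have h2 := key ht hr hrt
  have h3 : (p + r) * c = s + t := by rw [hc]; field_simp
  nlinarith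

/-- A prior `w` on `{0,1}` for a random variable with values `F₁, F₀`: the Gibbs variational
inequality. -/
lemma gibbs_binary {t w F₁ F₀ : ℝ} (ht : t ∈ Set.Icc (0 : ℝ) 1) (hw : w ∈ Set.Ioo (0 : ℝ) 1)
    (h₁ : 0 < F₁) (h₀ : 0 < F₀) :
    t * Real.log F₁ + (1 - t) * Real.log F₀ ≤
      Real.log (w * F₁ + (1 - w) * F₀) + klBinary t w := by
  have hw1 : 0 < 1 - w := by linarith [hw.2]
  have := log_sum_le ht.1 (sub_nonneg.2 ht.2) (mul_pos hw.1 h₁).le (mul_pos hw1 h₀).le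
    (fun h => absurd h (mul_pos hw.1 h₁).ne') (fun h => absurd h (mul_pos hw1 h₀).ne')
  have key : ∀ {u v F : ℝ}, 0 ≤ u → 0 < v → 0 < F →
      u * Real.log (u / (v * F)) = u * Real.log (u / v) - u * Real.log F := by
    intro u v F hu hv hF
    rcases hu.eq_or_lt with rfl | hu
    · simp
    rw [← div_div, Real.log_div (div_pos hu hv).ne' hF.ne']
    ring
  rw [key ht.1 hw.1 h₁, key (sub_nonneg.2 ht.2) hw1 h₀] at this
  rw [show t + (1 - t) = 1 by ring, one_div, Real.log_inv] at this
  unfold klBinary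
  linarith

section Feasible

variable {wq wu w₁ : ℝ}

lemma klMatrix_pairDist (T : Matrix (Fin 2) (Fin 2) ℝ) (wq wu w₁ : ℝ) :
    klMatrix T (pairDist wq wu w₁) =
      T 0 0 * Real.log (T 0 0 / w₁) + T 0 1 * Real.log (T 0 1 / (wq - w₁)) +
      (T 1 0 * Real.log (T 1 0 / (wu - w₁)) +
        T 1 1 * Real.log (T 1 1 / (1 - wq - wu + w₁))) := by
  simp [klMatrix, pairDist, Fin.sum_univ_two]

/-- Data processing: the divergence of a pair is at least the divergence of its first marginal. -/
lemma Feasible.klBinary_le_left {tq tu : ℝ} {T : Matrix (Fin 2) (Fin 2) ℝ}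
    (hT : Feasible (pairDist wq wu w₁) tq tu T) (hP : ∀ j k, 0 ≤ pairDist wq wu w₁ j k) :
    klBinary tq wq ≤ klMatrix T (pairDist wq wu w₁) := by
  obtain ⟨h0, h1, hac, rfl, rfl⟩ := hT
  have e1 := log_sum_le (h0 0 0) (h0 0 1) (hP 0 0) (hP 0 1) (hac 0 0) (hac 0 1)
  have e2 := log_sum_le (h0 1 0) (h0 1 1) (hP 1 0) (hP 1 1) (hac 1 0) (hac 1 1)
  simp only [Fin.sum_univ_two] at h1
  simp only [pairDist, Matrix.of_apply, Matrix.cons_val', Matrix.cons_val_zero,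
    Matrix.cons_val_one, Matrix.cons_val_fin_one] at e1 e2
  rw [klMatrix_pairDist, klBinary]
  rw [show w₁ + (wq - w₁) = wq by ring] at e1
  rw [show wu - w₁ + (1 - wq - wu + w₁) = 1 - wq by ring,
    show T 1 0 + T 1 1 = 1 - (T 0 0 + T 0 1) by linarith] at e2
  linarith

lemma Feasible.klBinary_le_right {tq tu : ℝ} {T : Matrix (Fin 2) (Fin 2) ℝ}
    (hT : Feasible (pairDist wq wu w₁) tq tu T) (hP : ∀ j k, 0 ≤ pairDist wq wu w₁ j k) :
    klBinary tu wu ≤ klMatrix T (pairDist wq wu w₁) := by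
  obtain ⟨h0, h1, hac, rfl, rfl⟩ := hT
  have e1 := log_sum_le (h0 0 0) (h0 1 0) (hP 0 0) (hP 1 0) (hac 0 0) (hac 1 0)
  have e2 := log_sum_le (h0 0 1) (h0 1 1) (hP 0 1) (hP 1 1) (hac 0 1) (hac 1 1)
  simp only [Fin.sum_univ_two] at h1
  simp only [pairDist, Matrix.of_apply, Matrix.cons_val', Matrix.cons_val_zero,
    Matrix.cons_val_one, Matrix.cons_val_fin_one] at e1 e2
  rw [klMatrix_pairDist, klBinary]
  rw [show w₁ + (wu - w₁) = wu by ring] at e1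
  rw [show wq - w₁ + (1 - wq - wu + w₁) = 1 - wu by ring,
    show T 0 1 + T 1 1 = 1 - (T 0 0 + T 1 0) by linarith] at e2
  linarith

lemma Feasible.mem_Icc {P T : Matrix (Fin 2) (Fin 2) ℝ} {tq tu : ℝ} (hT : Feasible P tq tu T) :
    tq ∈ Set.Icc (0 : ℝ) 1 ∧ tu ∈ Set.Icc (0 : ℝ) 1 := by
  obtain ⟨h0, h1, -, rfl, rfl⟩ := hT
  simp only [Fin.sum_univ_two] at h1
  have := h0 0 0
  have := h0 0 1
  have := h0 1 0
  have := h0 1 1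
  refine ⟨⟨?_, ?_⟩, ?_, ?_⟩ <;> linarith

lemma continuous_klMatrix (P : Matrix (Fin 2) (Fin 2) ℝ) :
    Continuous fun T : Matrix (Fin 2) (Fin 2) ℝ => klMatrix T P := by
  unfold klMatrix
  refine continuous_finsetSum _ fun j _ => continuous_finsetSum _ fun k _ => ?_
  have hc : Continuous fun T : Matrix (Fin 2) (Fin 2) ℝ => T j k :=
    (continuous_apply k).comp (continuous_apply j)
  have : Continuous fun t : ℝ => t * Real.log (t / P j k) := by
    by_cases h : P j k = 0
    · simpa [h] using continuous_const
    · have e : (fun t : ℝ => t * Real.log (t / P j k)) =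
          fun t => t * Real.log t - t * Real.log (P j k) := by
        funext t
        by_cases ht : t = 0
        · simp [ht]
        · rw [Real.log_div ht h]; ring
      rw [e]
      exact Real.continuous_mul_log.sub (continuous_id.mul continuous_const)
  exact this.comp hc

lemma isClosed_feasible (P : Matrix (Fin 2) (Fin 2) ℝ) (tq tu : ℝ) :
    IsClosed {T | Feasible P tq tu T} := by
  have hc : ∀ j k, Continuous fun T : Matrix (Fin 2) (Fin 2) ℝ => T j k := fun j k =>
    (continuous_apply k).comp (continuous_apply j)
  have hs : Continuous fun T : Matrix (Fin 2) (Fin 2) ℝ => ∑ j, ∑ k, T j k :=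
    continuous_finsetSum _ fun j _ => continuous_finsetSum _ fun k _ => hc j k
  simp only [Feasible, Set.ofPred_and, Set.ofPred_forall]
  refine (isClosed_iInter fun j => isClosed_iInter fun k =>
    isClosed_le continuous_const (hc j k)).inter ((isClosed_eq hs continuous_const).inter
      ((isClosed_iInter fun j => isClosed_iInter fun k => isClosed_iInter fun _ =>
        isClosed_eq (hc j k) continuous_const).inter
      ((isClosed_eq ((hc 0 0).add (hc 0 1)) continuous_const).inter
        (isClosed_eq ((hc 0 0).add (hc 1 0)) continuous_const))))

/-- The feasible set is compact and the divergence continuous on it, so the infimum is attained. -/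
lemma exists_isArgInf {P T₀ : Matrix (Fin 2) (Fin 2) ℝ} {tq tu : ℝ} (h : Feasible P tq tu T₀) :
    ∃ T, IsArgInf P tq tu T := by
  have hcomp : IsCompact {T | Feasible P tq tu T} := by
    have hK : IsCompact (Set.pi Set.univ fun _ : Fin 2 => Set.pi Set.univ fun _ : Fin 2 =>
        Set.Icc (0 : ℝ) 1) :=
      isCompact_univ_pi fun _ => isCompact_univ_pi fun _ => isCompact_Icc
    refine hK.of_isClosed_subset (isClosed_feasible P tq tu) fun T hT j _ k _ => ⟨hT.1 j k, ?_⟩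
    have h1 := hT.2.1
    have := hT.1 0 0
    have := hT.1 0 1
    have := hT.1 1 0
    have := hT.1 1 1
    simp only [Fin.sum_univ_two] at h1
    fin_cases j <;> fin_cases k <;> simp <;> linarith
  obtain ⟨T, hT, hmin⟩ := hcomp.exists_isMinOn ⟨T₀, h⟩ (continuous_klMatrix P).continuousOn
  exact ⟨T, hT, fun T' hT' => hmin hT'⟩

end Feasible

/-- Parameters of a nontrivial problem: `0 < w_q w_u < w₁ ≤ min w_q w_u` with `w_q, w_u ≤ 1`. -/
structure GapParams (wq wu w₁ : ℝ) : Prop where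
  q_le : wq ≤ 1
  u_le : wu ≤ 1
  q_nonneg : 0 ≤ wq
  u_nonneg : 0 ≤ wu
  mul_pos : 0 < wq * wu
  mul_lt : wq * wu < w₁
  le_q : w₁ ≤ wq
  le_u : w₁ ≤ wu

namespace GapParams

variable {wq wu w₁ : ℝ}

lemma q_pos (h : GapParams wq wu w₁) : 0 < wq :=
  h.q_nonneg.lt_of_ne fun h0 => by simpa [← h0] using h.mul_pos

lemma u_pos (h : GapParams wq wu w₁) : 0 < wu :=
  h.u_nonneg.lt_of_ne fun h0 => by simpa [← h0] using h.mul_pos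

lemma one_pos (h : GapParams wq wu w₁) : 0 < w₁ := h.mul_pos.trans h.mul_lt

lemma q_lt (h : GapParams wq wu w₁) : wq < 1 :=
  h.q_le.lt_of_ne fun h0 => by have := h.mul_lt; have := h.le_u; simp [h0] at *; linarith

lemma u_lt (h : GapParams wq wu w₁) : wu < 1 :=
  h.u_le.lt_of_ne fun h0 => by have := h.mul_lt; have := h.le_q; simp [h0] at *; linarith

lemma q_mem (h : GapParams wq wu w₁) : wq ∈ Set.Ioo (0 : ℝ) 1 := ⟨h.q_pos, h.q_lt⟩

lemma u_mem (h : GapParams wq wu w₁) : wu ∈ Set.Ioo (0 : ℝ) 1 := ⟨h.u_pos, h.u_lt⟩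

lemma none_pos (h : GapParams wq wu w₁) : 0 < 1 - wq - wu + w₁ := by
  nlinarith [h.mul_lt, mul_nonneg (sub_nonneg.2 h.q_le) (sub_nonneg.2 h.u_le)]

lemma pairDist_nonneg (h : GapParams wq wu w₁) (j k : Fin 2) : 0 ≤ pairDist wq wu w₁ j k := by
  have := h.one_pos
  have := h.none_pos
  have := h.le_q
  have := h.le_u
  fin_cases j <;> fin_cases k <;> simp [pairDist] <;> linarith

lemma tradeoffValues_nonneg (h : GapParams wq wu w₁) {α : ℝ} (hα : α ∈ Set.Icc (0 : ℝ) 1)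
    {v : ℝ} (hv : v ∈ tradeoffValues α wq wu w₁) : 0 ≤ v := by
  obtain ⟨tq, -, tu, htu, hne, T, hT, rfl⟩ := hv
  have h1 := hT.1.klBinary_le_left h.pairDist_nonneg
  have h2 := hT.1.klBinary_le_right h.pairDist_nonneg
  have h3 := klBinary_pos htu h.u_mem hne
  have := sub_nonneg.2 h1
  have := sub_nonneg.2 h2
  have := sub_nonneg.2 hα.2
  have := hα.1
  positivity

lemma tradeoffInf_nonneg (h : GapParams wq wu w₁) {α : ℝ} (hα : α ∈ Set.Icc (0 : ℝ) 1) :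
    0 ≤ tradeoffInf α wq wu w₁ :=
  Real.sInf_nonneg fun _ hv => h.tradeoffValues_nonneg hα hv

/-- The defining property of the trade-off infimum `lam`, for all feasible `T` and freed of
quotients: `D(T‖P) ≥ α d(t_q‖w_q) + (1 - α + lam) d(t_u‖w_u)`. -/
lemma klMatrix_ge (h : GapParams wq wu w₁) {α : ℝ} (hα : α ∈ Set.Icc (0 : ℝ) 1) {tq tu : ℝ}
    {T : Matrix (Fin 2) (Fin 2) ℝ} (hT : Feasible (pairDist wq wu w₁) tq tu T) :
    α * klBinary tq wq + (1 - α + tradeoffInf α wq wu w₁) * klBinary tu wu ≤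
      klMatrix T (pairDist wq wu w₁) := by
  obtain ⟨htq, htu⟩ := hT.mem_Icc
  have h1 := hT.klBinary_le_left h.pairDist_nonneg
  by_cases hne : tu = wu
  · -- here `d(t_u‖w_u) = 0`, and data processing suffices
    have h2 : klBinary tu wu = 0 := by rw [hne, klBinary_self h.u_mem]
    have h3 := klBinary_nonneg htq h.q_mem
    rw [h2]
    nlinarith [hα.1, hα.2]
  obtain ⟨T', hT'⟩ := exists_isArgInf hT
  have h3 := klBinary_pos htu h.u_mem hne
  have h4 : tradeoffInf α wq wu w₁ ≤ _ :=
    csInf_le ⟨0, fun _ hv => h.tradeoffValues_nonneg hα hv⟩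
      ⟨tq, htq, tu, htu, hne, T', hT', rfl⟩
  have h5 := hT'.2 T hT
  rw [← mul_div_assoc, ← mul_div_assoc, ← add_div, le_div_iff₀ h3] at h4
  linarith

/-- Any feasible `T`, minimal or not, bounds the trade-off infimum from above. -/
lemma tradeoffInf_mul_le (h : GapParams wq wu w₁) {α : ℝ} (hα : α ∈ Set.Icc (0 : ℝ) 1)
    {tq tu : ℝ} {T : Matrix (Fin 2) (Fin 2) ℝ} (hT : Feasible (pairDist wq wu w₁) tq tu T) :
    tradeoffInf α wq wu w₁ * klBinary tu wu ≤
      α * (klMatrix T (pairDist wq wu w₁) - klBinary tq wq) +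
        (1 - α) * (klMatrix T (pairDist wq wu w₁) - klBinary tu wu) := by
  linarith [h.klMatrix_ge hα hT]

lemma feasible_inter (h : GapParams wq wu w₁) :
    Feasible (pairDist wq wu w₁) 1 1 !![1, 0; 0, 0] := by
  refine ⟨?_, ?_, ?_, ?_, ?_⟩
  · intro j k; fin_cases j <;> fin_cases k <;> simp
  · simp [Fin.sum_univ_two]
  · intro j k; have := h.one_pos.ne'; fin_cases j <;> fin_cases k <;> simp [pairDist, this]
  · simp
  · simp

lemma feasible_none (h : GapParams wq wu w₁) :
    Feasible (pairDist wq wu w₁) 0 0 !![0, 0; 0, 1] := by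
  refine ⟨?_, ?_, ?_, ?_, ?_⟩
  · intro j k; fin_cases j <;> fin_cases k <;> simp
  · simp [Fin.sum_univ_two]
  · intro j k; have := h.none_pos.ne'; fin_cases j <;> fin_cases k <;> simp [pairDist, this]
  · simp
  · simp

/-- The bound on the trade-off infimum from the point mass at `(1, 1)`. -/
lemma tradeoffInf_mul_le_inter (h : GapParams wq wu w₁) {α : ℝ} (hα : α ∈ Set.Icc (0 : ℝ) 1) :
    tradeoffInf α wq wu w₁ * Real.log (1 / wu) ≤
      α * Real.log (wq / w₁) + (1 - α) * Real.log (wu / w₁) := by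
  have := h.tradeoffInf_mul_le hα h.feasible_inter
  simp [klMatrix_pairDist, klBinary] at this
  rw [one_div, Real.log_inv, Real.log_div h.q_pos.ne' h.one_pos.ne',
    Real.log_div h.u_pos.ne' h.one_pos.ne']
  linarith

/-- The bound on the trade-off infimum from the point mass at `(0, 0)`. -/
lemma tradeoffInf_mul_le_none (h : GapParams wq wu w₁) {α : ℝ} (hα : α ∈ Set.Icc (0 : ℝ) 1) :
    tradeoffInf α wq wu w₁ * Real.log (1 / (1 - wu)) ≤
      α * Real.log ((1 - wq) / (1 - wq - wu + w₁)) +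
        (1 - α) * Real.log ((1 - wu) / (1 - wq - wu + w₁)) := by
  have := h.tradeoffInf_mul_le hα h.feasible_none
  simp [klMatrix_pairDist, klBinary] at this
  rw [one_div, Real.log_inv, Real.log_div (sub_pos.2 h.q_lt).ne' h.none_pos.ne',
    Real.log_div (sub_pos.2 h.u_lt).ne' h.none_pos.ne']
  linarith

/-- Taking `t_u = 1` and `T` with the conditional law of the query bit under `P` shows that the
trade-off infimum is at most `α`. -/
lemma tradeoffInf_le (h : GapParams wq wu w₁) {α : ℝ} (hα : α ∈ Set.Icc (0 : ℝ) 1) :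
    tradeoffInf α wq wu w₁ ≤ α := by
  have hu := h.u_pos
  have h1 := h.one_pos
  have hle := h.le_u
  have hT : Feasible (pairDist wq wu w₁) (w₁ / wu) 1 !![w₁ / wu, 0; (wu - w₁) / wu, 0] := by
    refine ⟨?_, ?_, ?_, ?_, ?_⟩
    · intro j k
      have := div_nonneg h1.le hu.le
      have := div_nonneg (sub_nonneg.2 hle) hu.le
      fin_cases j <;> fin_cases k <;> simp <;> assumption
    · simp [Fin.sum_univ_two]; field_simp; ring
    · intro j k
      fin_cases j <;> fin_cases k <;> simp [pairDist]
      · exact fun h => Or.inl h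
      · exact fun h => Or.inl h
    · simp
    · simp; field_simp; ring
  have hD : klMatrix !![w₁ / wu, 0; (wu - w₁) / wu, 0] (pairDist wq wu w₁) = -Real.log wu := by
    have e1 : w₁ / wu / w₁ = wu⁻¹ := by field_simp
    simp only [klMatrix_pairDist, Matrix.of_apply, Matrix.cons_val', Matrix.cons_val_zero,
      Matrix.cons_val_one, Matrix.cons_val_fin_one, zero_mul, add_zero, e1, Real.log_inv]
    rcases hle.eq_or_lt with h2 | h2
    · rw [h2]; simp [hu.ne']
    · have e2 : (wu - w₁) / wu / (wu - w₁) = wu⁻¹ := by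
        have := (sub_pos.2 h2).ne'
        field_simp
      rw [e2, Real.log_inv]
      field_simp
      ring
  have hlog : 0 < -Real.log wu := neg_pos.2 (Real.log_neg hu h.u_lt)
  have hd : klBinary 1 wu = -Real.log wu := by simp [klBinary]
  have h0 : 0 ≤ klBinary (w₁ / wu) wq := klBinary_nonneg hT.mem_Icc.1 h.q_mem
  have := h.tradeoffInf_mul_le hα hT
  rw [hD, hd] at this
  have h2 : tradeoffInf α wq wu w₁ * (-Real.log wu) ≤ α * (-Real.log wu) := by
    nlinarith [hα.1]
  exact le_of_mul_le_mul_right h2 hlog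

end GapParams

/-! ### The two-function inequality for product distributions -/

/-- One coordinate: Gibbs' variational principle at `T ∝ P F^α G^β` turns the entropy inequality
`D(T‖P) ≥ α d(t_q‖w_q) + β d(t_u‖w_u)` into `E_P[F^α G^β] ≤ (E F)^α (E G)^β`. -/
lemma pair_ineq_of_pos {P : Matrix (Fin 2) (Fin 2) ℝ} {wq wu α β : ℝ}
    (hq : wq ∈ Set.Ioo (0 : ℝ) 1) (hu : wu ∈ Set.Ioo (0 : ℝ) 1) (hα : 0 ≤ α) (hβ : 0 ≤ β)
    (hP : ∀ j k, 0 ≤ P j k)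
    (hD : ∀ tq tu T, Feasible P tq tu T → α * klBinary tq wq + β * klBinary tu wu ≤ klMatrix T P)
    {F G : Fin 2 → ℝ} (hF : ∀ j, 0 < F j) (hG : ∀ k, 0 < G k) :
    ∑ j, ∑ k, P j k * (F j ^ α * G k ^ β) ≤
      (wq * F 0 + (1 - wq) * F 1) ^ α * (wu * G 0 + (1 - wu) * G 1) ^ β := by
  have hq1 := sub_pos.2 hq.2
  have hu1 := sub_pos.2 hu.2
  have hEF : 0 < wq * F 0 + (1 - wq) * F 1 :=
    add_pos (mul_pos hq.1 (hF 0)) (mul_pos hq1 (hF 1))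
  have hEG : 0 < wu * G 0 + (1 - wu) * G 1 :=
    add_pos (mul_pos hu.1 (hG 0)) (mul_pos hu1 (hG 1))
  set Z := ∑ j, ∑ k, P j k * (F j ^ α * G k ^ β) with hZ
  have hFG : ∀ j k, 0 < F j ^ α * G k ^ β := fun j k =>
    mul_pos (Real.rpow_pos_of_pos (hF j) _) (Real.rpow_pos_of_pos (hG k) _)
  have hZ0 : 0 ≤ Z := sum_nonneg fun j _ => sum_nonneg fun k _ =>
    mul_nonneg (hP j k) (hFG j k).le
  rcases hZ0.eq_or_lt with h0 | h0
  · rw [← h0]; positivity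
  set T : Matrix (Fin 2) (Fin 2) ℝ := fun j k => P j k * (F j ^ α * G k ^ β) / Z with hT
  have hTs : ∑ j, ∑ k, T j k = 1 := by
    simp only [hT, ← sum_div]
    exact div_self h0.ne'
  have hfeas : Feasible P (T 0 0 + T 0 1) (T 0 0 + T 1 0) T :=
    ⟨fun j k => div_nonneg (mul_nonneg (hP j k) (hFG j k).le) h0.le, hTs,
      fun j k h => by simp [hT, h], rfl, rfl⟩
  have h1 := hD _ _ _ hfeas
  have hlog : ∀ j k, T j k * Real.log (T j k / P j k) =
      T j k * (α * Real.log (F j) + β * Real.log (G k) - Real.log Z) := by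
    intro j k
    by_cases h : P j k = 0
    · simp [hT, h]
    · have e : T j k / P j k = F j ^ α * G k ^ β / Z := by
        simp only [hT]; field_simp
      rw [e, Real.log_div (hFG j k).ne' h0.ne', Real.log_mul
        (Real.rpow_pos_of_pos (hF j) _).ne' (Real.rpow_pos_of_pos (hG k) _).ne',
        Real.log_rpow (hF j), Real.log_rpow (hG k)]
  have hkl : klMatrix T P = α * ((T 0 0 + T 0 1) * Real.log (F 0) +
      (1 - (T 0 0 + T 0 1)) * Real.log (F 1)) + β * ((T 0 0 + T 1 0) * Real.log (G 0) +
      (1 - (T 0 0 + T 1 0)) * Real.log (G 1)) - Real.log Z := by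
    simp only [klMatrix, hlog]
    simp only [Fin.sum_univ_two] at hTs ⊢
    have e : T 1 1 = 1 - T 0 0 - T 0 1 - T 1 0 := by linarith
    rw [e]
    ring
  have h2 := mul_le_mul_of_nonneg_left
    (gibbs_binary hfeas.mem_Icc.1 hq (hF 0) (hF 1)) hα
  have h3 := mul_le_mul_of_nonneg_left
    (gibbs_binary hfeas.mem_Icc.2 hu (hG 0) (hG 1)) hβ
  rw [← Real.log_le_log_iff h0 (mul_pos (Real.rpow_pos_of_pos hEF _)
    (Real.rpow_pos_of_pos hEG _)), Real.log_mul (Real.rpow_pos_of_pos hEF _).ne'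
    (Real.rpow_pos_of_pos hEG _).ne', Real.log_rpow hEF, Real.log_rpow hEG]
  linarith

/-- The same for nonnegative functions, by continuity. -/
lemma pair_ineq {P : Matrix (Fin 2) (Fin 2) ℝ} {wq wu α β : ℝ}
    (hq : wq ∈ Set.Ioo (0 : ℝ) 1) (hu : wu ∈ Set.Ioo (0 : ℝ) 1) (hα : 0 ≤ α) (hβ : 0 ≤ β)
    (hP : ∀ j k, 0 ≤ P j k)
    (hD : ∀ tq tu T, Feasible P tq tu T → α * klBinary tq wq + β * klBinary tu wu ≤ klMatrix T P)
    {F G : Fin 2 → ℝ} (hF : ∀ j, 0 ≤ F j) (hG : ∀ k, 0 ≤ G k) :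
    ∑ j, ∑ k, P j k * (F j ^ α * G k ^ β) ≤
      (∑ j, ![wq, 1 - wq] j * F j) ^ α * (∑ k, ![wu, 1 - wu] k * G k) ^ β := by
  have ca := Real.continuous_rpow_const hα
  have cb := Real.continuous_rpow_const hβ
  have hl : Continuous fun e : ℝ => ∑ j, ∑ k, P j k * ((F j + e) ^ α * (G k + e) ^ β) := by
    refine continuous_finsetSum _ fun j _ => continuous_finsetSum _ fun k _ =>
      continuous_const.mul ((ca.comp ?_).mul (cb.comp ?_)) <;> fun_prop
  have hr : Continuous fun e : ℝ => (∑ j, ![wq, 1 - wq] j * (F j + e)) ^ α *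
      (∑ k, ![wu, 1 - wu] k * (G k + e)) ^ β := by
    refine (ca.comp ?_).mul (cb.comp ?_) <;> fun_prop
  have h1 := (hl.tendsto 0).mono_left (nhdsWithin_le_nhds (s := Set.Ioi 0))
  have h2 := (hr.tendsto 0).mono_left (nhdsWithin_le_nhds (s := Set.Ioi 0))
  simp only [add_zero] at h1 h2
  refine le_of_tendsto_of_tendsto h1 h2 ?_
  filter_upwards [self_mem_nhdsWithin] with e he
  have := pair_ineq_of_pos hq hu hα hβ hP hD (F := fun j => F j + e) (G := fun k => G k + e)
    (fun j => add_pos_of_nonneg_of_pos (hF j) he) (fun k => add_pos_of_nonneg_of_pos (hG k) he)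
  simpa [Fin.sum_univ_two] using this

lemma sum_pi_fin_succ {ι : Type*} [Fintype ι] {d : ℕ} (f : (Fin (d + 1) → ι) → ℝ) :
    ∑ x, f x = ∑ j, ∑ x : Fin d → ι, f (Fin.cons j x) := by
  rw [← Fintype.sum_prod_type', ← (Fin.consEquiv fun _ => ι).sum_comp]
  rfl

/-- The two-function inequality tensorizes. -/
lemma pair_ineq_pi {ι κ : Type*} [Fintype ι] [Fintype κ] {P : ι → κ → ℝ} {p : ι → ℝ} {r : κ → ℝ}
    {α β : ℝ} (hP : ∀ j k, 0 ≤ P j k) (hp : ∀ j, 0 ≤ p j) (hr : ∀ k, 0 ≤ r k)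
    (h : ∀ (F : ι → ℝ) (G : κ → ℝ), (∀ j, 0 ≤ F j) → (∀ k, 0 ≤ G k) →
      ∑ j, ∑ k, P j k * (F j ^ α * G k ^ β) ≤ (∑ j, p j * F j) ^ α * (∑ k, r k * G k) ^ β)
    (d : ℕ) (F : (Fin d → ι) → ℝ) (G : (Fin d → κ) → ℝ) (hF : ∀ x, 0 ≤ F x)
    (hG : ∀ y, 0 ≤ G y) :
    ∑ x, ∑ y, (∏ i, P (x i) (y i)) * (F x ^ α * G y ^ β) ≤
      (∑ x, (∏ i, p (x i)) * F x) ^ α * (∑ y, (∏ i, r (y i)) * G y) ^ β := by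
  induction d with
  | zero => simp
  | succ d ih =>
    have key := h (fun j => ∑ x : Fin d → ι, (∏ i, p (x i)) * F (Fin.cons j x))
      (fun k => ∑ y : Fin d → κ, (∏ i, r (y i)) * G (Fin.cons k y))
      (fun j => sum_nonneg fun x _ => mul_nonneg (prod_nonneg fun i _ => hp _) (hF _))
      (fun k => sum_nonneg fun y _ => mul_nonneg (prod_nonneg fun i _ => hr _) (hG _))
    have hl : ∑ x, ∑ y, (∏ i, P (x i) (y i)) * (F x ^ α * G y ^ β) =
        ∑ j, ∑ k, P j k * ∑ x : Fin d → ι, ∑ y : Fin d → κ, (∏ i, P (x i) (y i)) *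
          (F (Fin.cons j x) ^ α * G (Fin.cons k y) ^ β) := by
      rw [sum_pi_fin_succ]
      refine sum_congr rfl fun j _ => ?_
      simp_rw [sum_pi_fin_succ (d := d) (ι := κ), mul_sum]
      rw [sum_comm]
      refine sum_congr rfl fun k _ => sum_congr rfl fun x _ => sum_congr rfl fun y _ => ?_
      simp [Fin.prod_univ_succ, mul_assoc]
    have hx : ∑ x, (∏ i, p (x i)) * F x =
        ∑ j, p j * ∑ x : Fin d → ι, (∏ i, p (x i)) * F (Fin.cons j x) := by
      rw [sum_pi_fin_succ]
      simp [Fin.prod_univ_succ, mul_sum, mul_assoc]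
    have hy : ∑ x, (∏ i, r (x i)) * G x =
        ∑ j, r j * ∑ x : Fin d → κ, (∏ i, r (x i)) * G (Fin.cons j x) := by
      rw [sum_pi_fin_succ]
      simp [Fin.prod_univ_succ, mul_sum, mul_assoc]
    rw [hl, hx, hy]
    refine le_trans (sum_le_sum fun j _ => sum_le_sum fun k _ => ?_) key
    exact mul_le_mul_of_nonneg_left (ih _ _ (fun _ => hF _) fun _ => hG _) (hP j k)

/-! ### Events of constant probability for independent coordinates -/

section ProdProb

variable {σ : Type*} [Fintype σ] {d : ℕ}

open Classical in
/-- Probability of `E` when the `d` coordinates are independent with distribution `P`. -/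
noncomputable def prodProb (P : σ → ℝ) (E : (Fin d → σ) → Prop) : ℝ :=
  ∑ ω with E ω, ∏ i, P (ω i)

/-- The number of coordinates with value in `S`. -/
def hits [DecidableEq σ] (S : Finset σ) (ω : Fin d → σ) : ℕ := #{i | ω i ∈ S}

lemma sum_prod_apply (g : σ → ℝ) : ∑ ω : Fin d → σ, ∏ i, g (ω i) = (∑ s, g s) ^ d := by
  classical
  have := sum_prod_piFinset (ι := Fin d) (univ : Finset σ) (fun _ => g)
  simpa using this

lemma prodProb_mono {P : σ → ℝ} (hP : ∀ s, 0 ≤ P s) {E E' : (Fin d → σ) → Prop}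
    (h : ∀ ω, E ω → E' ω) : prodProb P E ≤ prodProb P E' := by
  classical
  refine sum_le_sum_of_subset_of_nonneg ?_ fun ω _ _ => prod_nonneg fun i _ => hP _
  exact monotone_filter_right _ (fun ω _ => h ω)

lemma prodProb_eq_zero {P : σ → ℝ} {E : (Fin d → σ) → Prop}
    (h : ∀ ω, E ω → ∏ i, P (ω i) = 0) : prodProb P E = 0 := by
  classical
  exact sum_eq_zero fun ω hω => h ω (mem_filter.1 hω).2

lemma prodProb_or_le {P : σ → ℝ} (hP : ∀ s, 0 ≤ P s) (E E' : (Fin d → σ) → Prop) :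
    prodProb P (fun ω => E ω ∨ E' ω) ≤ prodProb P E + prodProb P E' := by
  classical
  simp only [prodProb, filter_or]
  rw [← sum_union_inter]
  exact le_add_of_nonneg_right (sum_nonneg fun ω _ => prod_nonneg fun i _ => hP _)

lemma prodProb_add_not {P : σ → ℝ} (h1 : ∑ s, P s = 1) (E : (Fin d → σ) → Prop) :
    prodProb P E + prodProb P (fun ω => ¬ E ω) = 1 := by
  classical
  simp only [prodProb]
  rw [sum_filter_add_sum_filter_not, sum_prod_apply, h1, one_pow]

lemma half_le_prodProb {P : σ → ℝ} (hP : ∀ s, 0 ≤ P s) (h1 : ∑ s, P s = 1)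
    {E₁ E₂ E₃ : (Fin d → σ) → Prop} (e₁ : prodProb P (fun ω => ¬ E₁ ω) ≤ Real.exp (-3))
    (e₂ : prodProb P (fun ω => ¬ E₂ ω) ≤ Real.exp (-3))
    (e₃ : prodProb P (fun ω => ¬ E₃ ω) ≤ Real.exp (-3)) :
    1 / 2 ≤ prodProb P (fun ω => E₁ ω ∧ E₂ ω ∧ E₃ ω) := by
  have h := prodProb_add_not h1 (fun ω : Fin d → σ => E₁ ω ∧ E₂ ω ∧ E₃ ω)
  have h2 : prodProb P (fun ω => ¬ (E₁ ω ∧ E₂ ω ∧ E₃ ω)) ≤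
      prodProb P (fun ω => ¬ E₁ ω ∨ (¬ E₂ ω ∨ ¬ E₃ ω)) :=
    prodProb_mono hP fun ω => by tauto
  have h3 := prodProb_or_le hP (fun ω => ¬ E₁ ω) (fun ω => ¬ E₂ ω ∨ ¬ E₃ ω)
  have h4 := prodProb_or_le hP (fun ω => ¬ E₂ ω) (fun ω => ¬ E₃ ω)
  have h5 : Real.exp (-3) ≤ 1 / 6 := by
    rw [Real.exp_neg, one_div]
    refine inv_anti₀ (by norm_num) ?_
    have := Real.add_one_le_exp 1
    have h6 : Real.exp 3 = Real.exp 1 ^ 3 := by rw [← Real.exp_nat_mul]; norm_num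
    rw [h6]
    have : (2 : ℝ) ^ 3 ≤ Real.exp 1 ^ 3 := pow_le_pow_left₀ (by norm_num) (by linarith) 3
    linarith
  linarith

/-- Change of measure: an event of probability `1/2` for the expected numbers `n s + t s` of
coordinates with value `s` has probability at least `exp (-∑ t² / n) / 4` for the expected
numbers `n s`, by the Cauchy–Schwarz inequality. -/
lemma prodProb_ge_of_shift {n t : σ → ℝ} {c : ℝ} (hd : 0 < d) (hn : ∀ s, 0 ≤ n s)
    (hnd : ∑ s, n s = d) (ht : ∑ s, t s = 0) (hnt : ∀ s, n s = 0 → t s = 0)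
    (hc : ∑ s, t s ^ 2 / n s ≤ c) {E : (Fin d → σ) → Prop}
    (hE : 1 / 2 ≤ prodProb (fun s => (n s + t s) / d) E) :
    Real.exp (-c) / 4 ≤ prodProb (fun s => n s / d) E := by
  classical
  have hd' : (0 : ℝ) < d := Nat.cast_pos.2 hd
  set P : σ → ℝ := fun s => n s / d with hP
  set Q : σ → ℝ := fun s => (n s + t s) / d with hQ
  have hP0 : ∀ s, 0 ≤ P s := fun s => div_nonneg (hn s) hd'.le
  have hR : ∀ s, Q s ^ 2 = P s * (Q s ^ 2 / P s) := by
    intro s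
    by_cases h : n s = 0
    · simp [hP, hQ, h, hnt s h]
    · have : P s ≠ 0 := div_ne_zero h hd'.ne'
      field_simp
  have hR0 : ∀ s, 0 ≤ Q s ^ 2 / P s := fun s => div_nonneg (sq_nonneg _) (hP0 s)
  have h1 : prodProb Q E ^ 2 ≤ prodProb P E * ∑ ω with E ω, ∏ i, (Q (ω i) ^ 2 / P (ω i)) := by
    refine sum_sq_le_sum_mul_sum_of_sq_le_mul _ (fun ω _ => prod_nonneg fun i _ => hP0 _)
      (fun ω _ => prod_nonneg fun i _ => hR0 _) fun ω _ => ?_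
    rw [← prod_pow, ← prod_mul_distrib]
    exact (prod_congr rfl fun i _ => hR _).le
  have h2 : ∑ ω : Fin d → σ with E ω, ∏ i, (Q (ω i) ^ 2 / P (ω i)) ≤
      (∑ s, Q s ^ 2 / P s) ^ d := by
    rw [← sum_prod_apply]
    exact sum_le_sum_of_subset_of_nonneg (filter_subset _ _) fun ω _ _ =>
      prod_nonneg fun i _ => hR0 _
  have h3 : ∑ s, Q s ^ 2 / P s = 1 + (∑ s, t s ^ 2 / n s) / d := by
    have : ∀ s, Q s ^ 2 / P s = (n s + 2 * t s + t s ^ 2 / n s) / d := by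
      intro s
      by_cases h : n s = 0
      · simp [hP, hQ, h, hnt s h]
      · simp only [hP, hQ]; field_simp; ring
    simp_rw [this, ← sum_div, sum_add_distrib, ← mul_sum, ht, hnd]
    field_simp
    ring
  have h4 : (∑ s, Q s ^ 2 / P s) ^ d ≤ Real.exp c := by
    rw [h3]
    have h5 : 0 ≤ ∑ s, t s ^ 2 / n s := sum_nonneg fun s _ => div_nonneg (sq_nonneg _) (hn s)
    calc (1 + (∑ s, t s ^ 2 / n s) / d) ^ d ≤ Real.exp ((∑ s, t s ^ 2 / n s) / d) ^ d := by
          gcongr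
          linarith [Real.add_one_le_exp ((∑ s, t s ^ 2 / n s) / d)]
      _ = Real.exp (∑ s, t s ^ 2 / n s) := by
          rw [← Real.exp_nat_mul]; congr 1; field_simp
      _ ≤ _ := Real.exp_le_exp.2 hc
  have h5 : 0 ≤ prodProb P E := sum_nonneg fun ω _ => prod_nonneg fun i _ => hP0 _
  have h6 : (1 / 2 : ℝ) ^ 2 ≤ prodProb P E * Real.exp c :=
    (pow_le_pow_left₀ (by norm_num) hE 2).trans
      (h1.trans (mul_le_mul_of_nonneg_left (h2.trans h4) h5))
  rw [Real.exp_neg, div_le_iff₀ (by norm_num), inv_le_iff_one_le_mul₀ (Real.exp_pos c)]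
  linarith

variable [DecidableEq σ]

lemma exp_mul_hits {τ : Type*} [DecidableEq τ] (S : Finset τ) (ω : Fin d → τ) (s : ℝ) :
    Real.exp (s * hits S ω) = ∏ i, if ω i ∈ S then Real.exp s else 1 := by
  rw [prod_ite, prod_const, prod_const_one, mul_one, ← Real.exp_nat_mul, mul_comm]
  rfl

/-- Chernoff's bound, for both tails. -/
lemma prodProb_chernoff {P : σ → ℝ} (hP : ∀ s, 0 ≤ P s) (h1 : ∑ s, P s = 1) (S : Finset σ)
    {s : ℝ} (hs : |s| ≤ 1) (a : ℝ) :
    prodProb P (fun ω : Fin d → σ => s * a ≤ s * hits S ω) ≤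
      Real.exp (-(s * a) + (d * ∑ x ∈ S, P x) * (s + s ^ 2)) := by
  classical
  set p := ∑ x ∈ S, P x
  have hp : 0 ≤ p := sum_nonneg fun x _ => hP x
  have h2 : ∑ x, P x * (if x ∈ S then Real.exp s else 1) = 1 + p * (Real.exp s - 1) := by
    have : ∀ x, P x * (if x ∈ S then Real.exp s else 1) =
        P x + (if x ∈ S then P x else 0) * (Real.exp s - 1) := by
      intro x; split_ifs <;> ring
    simp_rw [this, sum_add_distrib, ← sum_mul, h1]
    congr 2
    simp [p]
  have h3 : 1 + p * (Real.exp s - 1) ≤ Real.exp (p * (s + s ^ 2)) := by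
    have h4 := (abs_le.1 (Real.abs_exp_sub_one_sub_id_le hs)).2
    have h5 := Real.add_one_le_exp (p * (s + s ^ 2))
    nlinarith [mul_le_mul_of_nonneg_left h4 hp]
  have h0 : 0 ≤ 1 + p * (Real.exp s - 1) := by
    rw [← h2]
    refine sum_nonneg fun x _ => mul_nonneg (hP x) ?_
    split_ifs
    · positivity
    · exact zero_le_one
  calc prodProb P (fun ω : Fin d → σ => s * a ≤ s * hits S ω)
      ≤ ∑ ω : Fin d → σ, (∏ i, P (ω i)) * Real.exp (-(s * a) + s * hits S ω) := by
        have hpos : ∀ ω : Fin d → σ, 0 ≤ ∏ i, P (ω i) := fun ω => prod_nonneg fun i _ => hP _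
        refine le_trans (sum_le_sum fun ω hω => ?_)
          (sum_le_sum_of_subset_of_nonneg (filter_subset _ univ) fun ω _ _ =>
            mul_nonneg (hpos ω) (Real.exp_pos _).le)
        have := (mem_filter.1 hω).2
        exact le_mul_of_one_le_right (hpos ω) (Real.one_le_exp (by linarith))
    _ = Real.exp (-(s * a)) * ∑ ω : Fin d → σ, ∏ i, (P (ω i) *
          (if ω i ∈ S then Real.exp s else 1)) := by
        rw [mul_sum]
        refine sum_congr rfl fun ω _ => ?_
        rw [Real.exp_add, exp_mul_hits, prod_mul_distrib]
        ring
    _ = Real.exp (-(s * a)) * (1 + p * (Real.exp s - 1)) ^ d := by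
        rw [sum_prod_apply (fun x => P x * (if x ∈ S then Real.exp s else 1)), h2]
    _ ≤ Real.exp (-(s * a)) * Real.exp (p * (s + s ^ 2)) ^ d := by gcongr
    _ = _ := by
        rw [← Real.exp_nat_mul, ← Real.exp_add]
        congr 1
        ring

lemma prodProb_upper_tail {P : σ → ℝ} (hP : ∀ s, 0 ≤ P s) (h1 : ∑ s, P s = 1) (S : Finset σ)
    {a ν : ℝ} (hν1 : 1 ≤ ν) (hν : d * ∑ x ∈ S, P x ≤ ν)
    (ha : d * ∑ x ∈ S, P x + 4 * √ν ≤ a) :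
    prodProb P (fun ω : Fin d → σ => a ≤ hits S ω) ≤ Real.exp (-3) := by
  set μ := d * ∑ x ∈ S, P x with hμ
  have hr : 1 ≤ √ν := Real.one_le_sqrt.2 hν1
  have hr0 : 0 < √ν := by linarith
  have hs : |1 / √ν| ≤ 1 := by
    rw [abs_of_pos (by positivity), div_le_one hr0]; exact hr
  have h2 := prodProb_chernoff (d := d) hP h1 S hs a
  rw [← hμ] at h2
  refine le_trans (prodProb_mono hP fun ω hω => ?_) (h2.trans (Real.exp_le_exp.2 ?_))
  · gcongr
  · have h3 : √ν ^ 2 = ν := Real.sq_sqrt (by linarith)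
    have h4 : μ * (1 / √ν) ^ 2 ≤ 1 := by
      rw [div_pow, h3, one_pow, mul_one_div, div_le_one (by linarith)]; exact hν
    have h5 : 1 / √ν * (μ + 4 * √ν) ≤ 1 / √ν * a := by gcongr
    have h6 : 1 / √ν * (μ + 4 * √ν) = μ * (1 / √ν) + 4 := by field_simp
    linarith

lemma prodProb_lower_tail {P : σ → ℝ} (hP : ∀ s, 0 ≤ P s) (h1 : ∑ s, P s = 1) (S : Finset σ)
    {a ν : ℝ} (hν1 : 1 ≤ ν) (hν : d * ∑ x ∈ S, P x ≤ ν)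
    (ha : a ≤ d * ∑ x ∈ S, P x - 4 * √ν) :
    prodProb P (fun ω : Fin d → σ => hits S ω ≤ a) ≤ Real.exp (-3) := by
  set μ := d * ∑ x ∈ S, P x with hμ
  have hr : 1 ≤ √ν := Real.one_le_sqrt.2 hν1
  have hr0 : 0 < √ν := by linarith
  have hs : |-(1 / √ν)| ≤ 1 := by
    rw [abs_neg, abs_of_pos (by positivity), div_le_one hr0]; exact hr
  have h2 := prodProb_chernoff (d := d) hP h1 S hs a
  rw [← hμ] at h2
  refine le_trans (prodProb_mono hP fun ω hω => ?_) (h2.trans (Real.exp_le_exp.2 ?_))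
  · rw [neg_mul, neg_mul, neg_le_neg_iff]
    gcongr
  · have h3 : √ν ^ 2 = ν := Real.sq_sqrt (by linarith)
    have h4 : μ * (-(1 / √ν)) ^ 2 ≤ 1 := by
      rw [neg_sq, div_pow, h3, one_pow, mul_one_div, div_le_one (by linarith)]; exact hν
    have h5 : 1 / √ν * a ≤ 1 / √ν * (μ - 4 * √ν) := by gcongr
    have h6 : 1 / √ν * (μ - 4 * √ν) = μ * (1 / √ν) - 4 := by field_simp
    linarith

lemma prodProb_hits_pos {P : σ → ℝ} {S : Finset σ} (hS : ∀ s ∈ S, P s = 0) :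
    prodProb P (fun ω : Fin d → σ => 0 < hits S ω) = 0 := by
  refine prodProb_eq_zero fun ω hω => ?_
  obtain ⟨i, hi⟩ := card_pos.1 hω
  exact prod_eq_zero (mem_univ i) (hS _ (mem_filter.1 hi).2)

end ProdProb

section FourCells

variable {d : ℕ}

lemma hits_add_hits {σ : Type*} [Fintype σ] [DecidableEq σ] (S : Finset σ) (ω : Fin d → σ) :
    hits S ω + hits Sᶜ ω = d := by
  have := card_filter_add_card_filter_not (s := (univ : Finset (Fin d))) (fun i => ω i ∈ S)
  simpa [hits] using this

/-- For words over four cells with expected numbers of letters `K, A, B, C`: one of the two ways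
in which the actual numbers can deviate from the expected ones so that a pair of sets with these
numbers can be changed into one with the expected sizes, by enlarging the first set and enlarging
(first alternative) or shrinking (second alternative) the second one, whatever elements are added
or removed, without making the intersection smaller than `K`. -/
def Correctable (K A B : ℕ) (ω : Fin d → Fin 4) : Prop :=
  (K ≤ hits {0} ω ∧ hits {0, 1} ω ≤ K + A ∧ hits {0, 2} ω ≤ K + B) ∨
    (hits {2} ω ≤ B ∧ hits {0, 1} ω ≤ K + A ∧ K + B ≤ hits {0, 2} ω)

lemma sq_add_three_le {x y z X : ℝ} (h : x ^ 2 + y ^ 2 + z ^ 2 ≤ X) :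
    (x + y + z) ^ 2 ≤ 3 * X := by
  nlinarith [sq_nonneg (x - y), sq_nonneg (x - z), sq_nonneg (y - z)]

lemma le_of_sq_le_mul {x c X : ℝ} (h : x ^ 2 ≤ c * X) (hX : 0 ≤ X) (hc : c ≤ X) : x ≤ X := by
  refine (abs_le_of_sq_le_sq' (h.trans ?_) hX).2
  rw [sq]
  exact mul_le_mul_of_nonneg_right hc hX

lemma sum_univ_four_div {t n : Fin 4 → ℝ} {c₀ c₁ c₂ c₃ : ℝ} (hn : ∀ i, 0 ≤ n i)
    (hc₀ : 0 ≤ c₀) (hc₁ : 0 ≤ c₁) (hc₂ : 0 ≤ c₂) (hc₃ : 0 ≤ c₃)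
    (h₀ : t 0 ^ 2 ≤ c₀ * n 0) (h₁ : t 1 ^ 2 ≤ c₁ * n 1) (h₂ : t 2 ^ 2 ≤ c₂ * n 2)
    (h₃ : t 3 ^ 2 ≤ c₃ * n 3) : ∑ i, t i ^ 2 / n i ≤ c₀ + c₁ + c₂ + c₃ := by
  rw [Fin.sum_univ_four]
  have := div_le_of_le_mul₀ (hn 0) hc₀ h₀
  have := div_le_of_le_mul₀ (hn 1) hc₁ h₁
  have := div_le_of_le_mul₀ (hn 2) hc₂ h₂
  have := div_le_of_le_mul₀ (hn 3) hc₃ h₃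
  linarith

/-- A mean of `x + 20 √x`, itself the parameter of the tail bound, exceeds `x` by enough for
`prodProb_lower_tail`. -/
lemma four_mul_sqrt_add_le {x : ℝ} (hx : 0 ≤ x) : 4 * √(x + 20 * √x) ≤ 20 * √x ∨ x < 1 := by
  by_cases h : x < 1
  · exact Or.inr h
  left
  push Not at h
  have h1 : √x ^ 2 = x := Real.sq_sqrt hx
  have h2 : 1 ≤ √x := Real.one_le_sqrt.2 h
  have h3 : √(x + 20 * √x) ≤ 5 * √x := by
    rw [Real.sqrt_le_left (by positivity)]
    nlinarith
  linarith

section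

variable {K A B C : ℕ}

/-- Large `B`: all of `K`, `A`, `B`, `C` have room for shifts of the order of the standard
deviations of the sizes of both sets. -/
lemma prodProb_enlarge_both (hd : d = K + A + B + C) (hK : 1 ≤ K) (hBA : B ≤ A)
    (hKC : A * B ≤ K * C) (hB : 3600 * K ≤ B) :
    Real.exp (-9600) / 4 ≤ prodProb (fun s => ![(K : ℝ), A, B, C] s / d)
      (fun ω : Fin d → Fin 4 => K ≤ hits {0} ω ∧ hits {0, 1} ω ≤ K + A ∧
        hits {0, 2} ω ≤ K + B) := by
  have hd' : (d : ℝ) = K + A + B + C := by exact_mod_cast hd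
  have hK' : (1 : ℝ) ≤ K := by exact_mod_cast hK
  have hBA' : (B : ℝ) ≤ A := by exact_mod_cast hBA
  have hB' : 3600 * (K : ℝ) ≤ B := by exact_mod_cast hB
  have hC' : (A : ℝ) ≤ C := by
    have h1 : (A : ℝ) * B ≤ K * C := by exact_mod_cast hKC
    have h2 : (K : ℝ) * A ≤ K * C := by nlinarith
    exact le_of_mul_le_mul_left h2 (by linarith)
  have hdpos : (0 : ℝ) < d := by linarith
  obtain ⟨s, hs⟩ : ∃ s, s = 20 * √(K : ℝ) := ⟨_, rfl⟩
  obtain ⟨u, hu⟩ : ∃ u, u = 20 * √(K + A : ℝ) := ⟨_, rfl⟩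
  obtain ⟨v, hv⟩ : ∃ v, v = 20 * √(K + B : ℝ) := ⟨_, rfl⟩
  have hs0 : 0 ≤ s := by rw [hs]; positivity
  have hu0 : 0 ≤ u := by rw [hu]; positivity
  have hv0 : 0 ≤ v := by rw [hv]; positivity
  have hs2 : s ^ 2 = 400 * K := by rw [hs, mul_pow, Real.sq_sqrt (by linarith)]; norm_num
  have hu2 : u ^ 2 = 400 * (K + A) := by rw [hu, mul_pow, Real.sq_sqrt (by linarith)]; norm_num
  have hv2 : v ^ 2 = 400 * (K + B) := by rw [hv, mul_pow, Real.sq_sqrt (by linarith)]; norm_num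
  have cA : (s + u) ^ 2 ≤ 1600 * A := by nlinarith [sq_nonneg (s - u)]
  have cB : (s + v) ^ 2 ≤ 1600 * B := by nlinarith [sq_nonneg (s - v)]
  have cC : (s + u + v) ^ 2 ≤ 6000 * C := by
    have := sq_add_three_le (x := s) (y := u) (z := v) le_rfl
    linarith
  have lA : s + u ≤ A := le_of_sq_le_mul cA (by linarith) (by linarith)
  have lB : s + v ≤ B := le_of_sq_le_mul cB (by linarith) (by linarith)
  set n : Fin 4 → ℝ := ![(K : ℝ), A, B, C] with hn
  set t : Fin 4 → ℝ := ![s, -(s + u), -(s + v), s + u + v] with ht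
  have hn0 : ∀ i, 0 ≤ n i := by intro i; fin_cases i <;> simp [hn]
  have hnt0 : ∀ i, 0 ≤ (n i + t i) / d := by
    intro i
    refine div_nonneg ?_ hdpos.le
    fin_cases i <;> simp [hn, ht] <;> linarith
  have hsum : ∑ i, n i = d := by rw [hd']; simp [hn, Fin.sum_univ_four]
  have htsum : ∑ i, t i = 0 := by simp only [ht, Fin.sum_univ_four]; simp; ring
  have hQ1 : ∑ i, (n i + t i) / d = 1 := by
    rw [← sum_div, sum_add_distrib, hsum, htsum, add_zero, div_self hdpos.ne']
  refine prodProb_ge_of_shift (c := 9600) (t := t) (Nat.cast_pos.1 hdpos) hn0 hsum htsum ?_ ?_ ?_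
  · intro i h
    have hK0 : (0 : ℝ) < K := by linarith
    have hB0 : (0 : ℝ) < B := by linarith
    have hA0 : (0 : ℝ) < A := by linarith
    have hC0 : (0 : ℝ) < C := by linarith
    have : (0 : ℝ) < n i := by
      fin_cases i
      exacts [hK0, hA0, hB0, hC0]
    exact absurd h this.ne'
  · refine (sum_univ_four_div (c₀ := 400) (c₁ := 1600) (c₂ := 1600) (c₃ := 6000) hn0
      (by norm_num) (by norm_num) (by norm_num) (by norm_num) ?_ ?_ ?_ ?_).trans (by norm_num)
    · simp [hn, ht, hs2]
    · simp only [hn, ht, Matrix.cons_val]; rw [neg_sq]; exact cA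
    · simp only [hn, ht, Matrix.cons_val]; rw [neg_sq]; exact cB
    · simp only [hn, ht, Matrix.cons_val]; exact cC
  have e0 : d * ∑ i ∈ ({0} : Finset (Fin 4)), (n i + t i) / d = K + s := by
    simp [hn, ht]; field_simp
  have e1 : d * ∑ i ∈ ({0, 1} : Finset (Fin 4)), (n i + t i) / d = K + A - u := by
    simp [hn, ht]; field_simp; ring
  have e2 : d * ∑ i ∈ ({0, 2} : Finset (Fin 4)), (n i + t i) / d = K + B - v := by
    simp [hn, ht]; field_simp; ring
  refine half_le_prodProb hnt0 hQ1 ?_ ?_ ?_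
  · refine (prodProb_mono hnt0 fun ω h => ?_).trans
      (prodProb_lower_tail hnt0 hQ1 {0} (a := K) (ν := K + s) (by linarith) e0.le ?_)
    · exact_mod_cast (not_le.1 h).le
    · rw [e0]
      rcases four_mul_sqrt_add_le (x := K) (by linarith) with h | h
      · rw [hs]; linarith
      · linarith
  · refine (prodProb_mono hnt0 fun ω h => ?_).trans
      (prodProb_upper_tail hnt0 hQ1 {0, 1} (a := K + A) (ν := K + A) (by linarith)
        (by rw [e1]; linarith) ?_)
    · exact_mod_cast (not_le.1 h).le
    · rw [e1, hu]; linarith [Real.sqrt_nonneg (K + A : ℝ)]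
  · refine (prodProb_mono hnt0 fun ω h => ?_).trans
      (prodProb_upper_tail hnt0 hQ1 {0, 2} (a := K + B) (ν := K + B) (by linarith)
        (by rw [e2]; linarith) ?_)
    · exact_mod_cast (not_le.1 h).le
    · rw [e2, hv]; linarith [Real.sqrt_nonneg (K + B : ℝ)]

/-- `B` at most of the order of `K`. The first set is to be enlarged: its size has the standard
deviation `√(K + A)` or `√(B + C)`, whichever is smaller, and the shift takes the smaller one,
since only that one is sure to fit into both `A` and `C`. -/
lemma prodProb_shrink_second {L : ℝ} (hd : d = K + A + B + C) (hK : 1 ≤ K) (hC : 1 ≤ C)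
    (hBA : B ≤ A) (hKC : A * B ≤ K * C) (hB : B ≤ 3600 * K) (hL : 1 ≤ L) (hLA : (K : ℝ) ≤ L * A)
    (hA : 3600 * (1 + L) ≤ A) :
    Real.exp (-(5764400 + 5200 * (1 + L))) / 4 ≤ prodProb (fun s => ![(K : ℝ), A, B, C] s / d)
      (fun ω : Fin d → Fin 4 => hits {2} ω ≤ B ∧ hits {0, 1} ω ≤ K + A ∧
        K + B ≤ hits {0, 2} ω) := by
  have hd' : (d : ℝ) = K + A + B + C := by exact_mod_cast hd
  have hK' : (1 : ℝ) ≤ K := by exact_mod_cast hK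
  have hC' : (1 : ℝ) ≤ C := by exact_mod_cast hC
  have hBA' : (B : ℝ) ≤ A := by exact_mod_cast hBA
  have hB' : (B : ℝ) ≤ 3600 * K := by exact_mod_cast hB
  have hA1 : (1 : ℝ) ≤ A := by linarith
  have hB0 : (0 : ℝ) ≤ B := Nat.cast_nonneg B
  have hBC : (B : ℝ) ≤ L * C := by
    have h1 : (A : ℝ) * B ≤ K * C := by exact_mod_cast hKC
    have h2 : (K : ℝ) * C ≤ L * A * C := by gcongr
    have h3 : (A : ℝ) * B ≤ A * (L * C) := by linarith
    exact le_of_mul_le_mul_left h3 (by linarith)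
  have hdpos : (0 : ℝ) < d := by linarith
  obtain ⟨s, hs⟩ : ∃ s, s = 20 * √(K + B : ℝ) := ⟨_, rfl⟩
  obtain ⟨m, hm⟩ : ∃ m, m = min (B + C : ℝ) (K + A) := ⟨_, rfl⟩
  obtain ⟨u, hu⟩ : ∃ u, u = 20 * √m := ⟨_, rfl⟩
  obtain ⟨v, hv⟩ : ∃ v, v = min (B : ℝ) (20 * √(B : ℝ)) := ⟨_, rfl⟩
  have hm1 : 1 ≤ m := by rw [hm]; exact le_min (by linarith) (by linarith)
  have hmC : m ≤ (1 + L) * C := by rw [hm]; exact (min_le_left _ _).trans (by linarith)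
  have hmA : m ≤ (1 + L) * A := by rw [hm]; exact (min_le_right _ _).trans (by linarith)
  have hs0 : 0 ≤ s := by rw [hs]; positivity
  have hu0 : 0 ≤ u := by rw [hu]; positivity
  have hv0 : 0 ≤ v := by rw [hv]; positivity
  have hvB : v ≤ B := by rw [hv]; exact min_le_left _ _
  have hs2 : s ^ 2 = 400 * (K + B) := by rw [hs, mul_pow, Real.sq_sqrt (by linarith)]; norm_num
  have hu2 : u ^ 2 = 400 * m := by rw [hu, mul_pow, Real.sq_sqrt (by linarith)]; norm_num
  have hv2 : v ^ 2 ≤ 400 * B := by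
    have h1 : v ≤ 20 * √(B : ℝ) := by rw [hv]; exact min_le_right _ _
    have h2 : v ^ 2 ≤ (20 * √(B : ℝ)) ^ 2 := by gcongr
    rw [mul_pow, Real.sq_sqrt hB0] at h2
    linarith
  have cK : (v + s) ^ 2 ≤ 5762000 * K := by nlinarith [sq_nonneg (v - s)]
  have cA : (s + v + u) ^ 2 ≤ 3600 * (1 + L) * A := by
    have := sq_add_three_le (x := s) (y := v) (z := u) le_rfl
    nlinarith
  have cC : (v + u) ^ 2 ≤ 1600 * (1 + L) * C := by nlinarith [sq_nonneg (v - u)]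
  have lA : s + v + u ≤ A := le_of_sq_le_mul cA (by linarith) hA
  set n : Fin 4 → ℝ := ![(K : ℝ), A, B, C] with hn
  set t : Fin 4 → ℝ := ![v + s, -(s + v + u), -v, v + u] with ht
  have hn0 : ∀ i, 0 ≤ n i := by intro i; fin_cases i <;> simp [hn]
  have hnt0 : ∀ i, 0 ≤ (n i + t i) / d := by
    intro i
    refine div_nonneg ?_ hdpos.le
    fin_cases i <;> simp [hn, ht] <;> linarith
  have hsum : ∑ i, n i = d := by rw [hd']; simp [hn, Fin.sum_univ_four]
  have htsum : ∑ i, t i = 0 := by simp only [ht, Fin.sum_univ_four]; simp; ring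
  have hQ1 : ∑ i, (n i + t i) / d = 1 := by
    rw [← sum_div, sum_add_distrib, hsum, htsum, add_zero, div_self hdpos.ne']
  have c0 : t 0 ^ 2 ≤ 5762000 * n 0 := by simp only [hn, ht, Matrix.cons_val]; exact cK
  have c1 : t 1 ^ 2 ≤ 3600 * (1 + L) * n 1 := by
    simp only [hn, ht, Matrix.cons_val]; rw [neg_sq]; exact cA
  have c2 : t 2 ^ 2 ≤ 400 * n 2 := by
    simp only [hn, ht, Matrix.cons_val]; rw [neg_sq]; exact hv2
  have c3 : t 3 ^ 2 ≤ 1600 * (1 + L) * n 3 := by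
    simp only [hn, ht, Matrix.cons_val]; exact cC
  refine prodProb_ge_of_shift (c := 5764400 + 5200 * (1 + L)) (t := t) (Nat.cast_pos.1 hdpos)
    hn0 hsum htsum ?_ ?_ ?_
  · intro i h
    have : t i ^ 2 ≤ 0 := by
      fin_cases i
      · exact c0.trans_eq (by simp [show n 0 = 0 from h])
      · exact c1.trans_eq (by simp [show n 1 = 0 from h])
      · exact c2.trans_eq (by simp [show n 2 = 0 from h])
      · exact c3.trans_eq (by simp [show n 3 = 0 from h])
    exact pow_eq_zero_iff two_ne_zero |>.1 (le_antisymm this (sq_nonneg _))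
  · refine (sum_univ_four_div hn0 (by norm_num) (by linarith) (by norm_num) (by linarith)
      c0 c1 c2 c3).trans (by linarith)
  have e2 : d * ∑ i ∈ ({2} : Finset (Fin 4)), (n i + t i) / d = B - v := by
    simp [hn, ht]; field_simp; ring
  have e01 : d * ∑ i ∈ ({0, 1} : Finset (Fin 4)), (n i + t i) / d = K + A - u := by
    simp [hn, ht]; field_simp; ring
  have e23 : d * ∑ i ∈ ({2, 3} : Finset (Fin 4)), (n i + t i) / d = B + C + u := by
    simp [hn, ht]; field_simp; ring
  have e02 : d * ∑ i ∈ ({0, 2} : Finset (Fin 4)), (n i + t i) / d = K + B + s := by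
    simp [hn, ht]; field_simp; ring
  refine half_le_prodProb hnt0 hQ1 ?_ ?_ ?_
  · rcases le_total (B : ℝ) (20 * √(B : ℝ)) with h | h
    · -- here the shifted number of letters `2` vanishes
      have hvB' : v = B := by rw [hv, min_eq_left h]
      refine (prodProb_mono hnt0 fun ω h => ?_).trans
        ((prodProb_hits_pos (S := {2}) ?_).le.trans (Real.exp_pos _).le)
      · exact Nat.pos_of_ne_zero fun h0 => h (by omega)
      · intro i hi
        rw [mem_singleton.1 hi]
        simp [hn, ht, hvB']
    · have hvB' : v = 20 * √(B : ℝ) := by rw [hv, min_eq_right h]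
      by_cases hB1 : (1 : ℝ) ≤ B
      · refine (prodProb_mono hnt0 fun ω h => ?_).trans
          (prodProb_upper_tail hnt0 hQ1 {2} (a := B) (ν := B) hB1 (by rw [e2]; linarith) ?_)
        · exact_mod_cast (not_le.1 h).le
        · rw [e2, hvB']; linarith [Real.sqrt_nonneg (B : ℝ)]
      · have hB2 : (B : ℝ) = 0 := by
          have : B < 1 := by
            by_contra h3
            exact hB1 (by exact_mod_cast not_lt.1 h3)
          exact_mod_cast Nat.lt_one_iff.1 this
        refine (prodProb_mono hnt0 fun ω h => ?_).trans
          ((prodProb_hits_pos (S := {2}) ?_).le.trans (Real.exp_pos _).le)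
        · exact Nat.pos_of_ne_zero fun h0 => h (by omega)
        · intro i hi
          rw [mem_singleton.1 hi]
          simp [hn, ht, hvB', hB2]
  · rcases le_total (B + C : ℝ) (K + A) with h | h
    · have hm' : m = B + C := by rw [hm, min_eq_left h]
      refine (prodProb_mono hnt0 fun ω h => ?_).trans
        (prodProb_lower_tail hnt0 hQ1 {2, 3} (a := B + C) (ν := B + C + u) (by linarith) e23.le ?_)
      · have h1 := hits_add_hits {0, 1} ω
        rw [show ({0, 1} : Finset (Fin 4))ᶜ = {2, 3} by decide] at h1
        have : hits {2, 3} ω ≤ B + C := by omega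
        exact_mod_cast this
      · rw [e23]
        rcases four_mul_sqrt_add_le (x := B + C) (by linarith) with h | h
        · rw [hu, hm']; linarith
        · linarith
    · have hm' : m = K + A := by rw [hm, min_eq_right h]
      refine (prodProb_mono hnt0 fun ω h => ?_).trans
        (prodProb_upper_tail hnt0 hQ1 {0, 1} (a := K + A) (ν := K + A) (by linarith)
          (by rw [e01]; linarith) ?_)
      · exact_mod_cast (not_le.1 h).le
      · rw [e01, hu, hm']; linarith [Real.sqrt_nonneg (K + A : ℝ)]
  · refine (prodProb_mono hnt0 fun ω h => ?_).trans
      (prodProb_lower_tail hnt0 hQ1 {0, 2} (a := K + B) (ν := K + B + s) (by linarith) e02.le ?_)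
    · exact_mod_cast (not_le.1 h).le
    · rw [e02]
      rcases four_mul_sqrt_add_le (x := K + B) (by linarith) with h | h
      · rw [hs]; linarith
      · linarith

lemma prodProb_correctable {L : ℝ} (hd : d = K + A + B + C) (hK : 1 ≤ K) (hC : 1 ≤ C)
    (hBA : B ≤ A) (hKC : A * B ≤ K * C) (hL : 1 ≤ L) (hLA : (K : ℝ) ≤ L * A)
    (hA : 3600 * (1 + L) ≤ A) :
    Real.exp (-(5764400 + 5200 * (1 + L))) / 4 ≤
      prodProb (fun s => ![(K : ℝ), A, B, C] s / d) (Correctable (d := d) K A B) := by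
  have h0 : ∀ s, 0 ≤ ![(K : ℝ), A, B, C] s / d := by
    intro i
    refine div_nonneg ?_ (Nat.cast_nonneg _)
    fin_cases i <;> simp
  rcases le_total B (3600 * K) with h | h
  · exact (prodProb_shrink_second hd hK hC hBA hKC h hL hLA hA).trans
      (prodProb_mono h0 fun ω hω => Or.inr hω)
  · refine le_trans ?_ ((prodProb_enlarge_both hd hK hBA hKC h).trans
      (prodProb_mono h0 fun ω hω => Or.inl hω))
    gcongr
    linarith

end

end FourCells

/-! ### From product distributions to sets of fixed sizes -/

section Correction

variable {d : ℕ}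

/-- The set encoded by a word over `{0, 1}`; as in `pairDist`, the letter `0` marks membership. -/
def wordSet (x : Fin d → Fin 2) : Finset (Fin d) := {i | x i = 0}

/-- The sets of size `k` obtained from `X` by only adding or only removing elements. -/
def nearSets (k : ℕ) (X : Finset (Fin d)) : Finset (Finset (Fin d)) :=
  {q | q.card = k ∧ (q ⊆ X ∨ X ⊆ q)}

lemma mem_nearSets {k : ℕ} {X q : Finset (Fin d)} :
    q ∈ nearSets k X ↔ q.card = k ∧ (q ⊆ X ∨ X ⊆ q) := by
  simp [nearSets]

lemma nearSets_nonempty {k : ℕ} (hk : k ≤ d) (X : Finset (Fin d)) : (nearSets k X).Nonempty := by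
  rcases le_total k X.card with h | h
  · obtain ⟨q, hq, hc⟩ := exists_subset_card_eq h
    exact ⟨q, mem_nearSets.2 ⟨hc, Or.inl hq⟩⟩
  · obtain ⟨q, hq, -, hc⟩ := exists_subsuperset_card_eq (subset_univ X) h (by simpa using hk)
    exact ⟨q, mem_nearSets.2 ⟨hc, Or.inr hq⟩⟩

lemma subset_of_mem_nearSets {k : ℕ} {X q : Finset (Fin d)} (h : q ∈ nearSets k X)
    (hX : k ≤ X.card) : q ⊆ X := by
  obtain ⟨hc, h | h⟩ := mem_nearSets.1 h
  · exact h
  · exact (eq_of_subset_of_card_le h (by omega)).ge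

lemma superset_of_mem_nearSets {k : ℕ} {X q : Finset (Fin d)} (h : q ∈ nearSets k X)
    (hX : X.card ≤ k) : X ⊆ q := by
  obtain ⟨hc, h | h⟩ := mem_nearSets.1 h
  · exact (eq_of_subset_of_card_le h (by omega)).ge
  · exact h

/-- Whatever sets of sizes `kq` and `ku` are made from `X` and `Y` by adding or removing elements,
they meet in at least `k₁` elements. -/
def AlwaysClose (kq ku k₁ : ℕ) (X Y : Finset (Fin d)) : Prop :=
  ∀ q ∈ nearSets kq X, ∀ y ∈ nearSets ku Y, k₁ ≤ (q ∩ y).card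

variable {K A B C : ℕ} {X Y : Finset (Fin d)}

lemma alwaysClose_add_add (h : K ≤ (X ∩ Y).card) (hX : X.card ≤ K + A) (hY : Y.card ≤ K + B) :
    AlwaysClose (K + A) (K + B) K X Y := fun _ hq _ hy =>
  h.trans (card_le_card (inter_subset_inter (superset_of_mem_nearSets hq hX)
    (superset_of_mem_nearSets hy hY)))

lemma alwaysClose_add_remove (h : (Y \ X).card ≤ B) (hX : X.card ≤ K + A)
    (hY : K + B ≤ Y.card) : AlwaysClose (K + A) (K + B) K X Y := by
  intro q hq y hy
  have h1 := card_le_card (sdiff_subset_sdiff (subset_of_mem_nearSets hy hY)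
    (superset_of_mem_nearSets hq hX))
  have h2 := card_sdiff_add_card_inter y q
  have h3 := (mem_nearSets.1 hy).1
  rw [inter_comm]
  omega

lemma alwaysClose_remove_add (h : (X \ Y).card ≤ A) (hX : K + A ≤ X.card)
    (hY : Y.card ≤ K + B) : AlwaysClose (K + A) (K + B) K X Y := by
  intro q hq y hy
  rw [inter_comm]
  exact alwaysClose_add_remove h hY hX y hy q hq

lemma alwaysClose_remove_remove (hd : d = K + A + B + C) (h : C ≤ (X ∪ Y)ᶜ.card)
    (hX : K + A ≤ X.card) (hY : K + B ≤ Y.card) : AlwaysClose (K + A) (K + B) K X Y := by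
  intro q hq y hy
  have h1 := card_le_card (union_subset_union (subset_of_mem_nearSets hq hX)
    (subset_of_mem_nearSets hy hY))
  have h2 := card_union_add_card_inter q y
  have h3 := (mem_nearSets.1 hy).1
  have h4 := (mem_nearSets.1 hq).1
  have h5 := card_add_card_compl (X ∪ Y)
  rw [Fintype.card_fin] at h5
  omega

/-- The pair of sets of a word over `{0,1}²` is always close after correction of the sizes. -/
def CloseWord (kq ku k₁ : ℕ) (ω : Fin d → Fin 2 × Fin 2) : Prop :=
  AlwaysClose kq ku k₁ (wordSet fun i => (ω i).1) (wordSet fun i => (ω i).2)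

lemma hits_eq_card {σ τ : Type*} [DecidableEq σ] {S : Finset σ} {f : σ → τ} {Q : τ → Prop}
    [DecidablePred Q] (h : ∀ s, s ∈ S ↔ Q (f s)) (ω : Fin d → σ) :
    hits S ω = #{i | Q (f (ω i))} := by
  simp [hits, h]

lemma prodProb_comp {σ τ : Type*} [Fintype σ] [Fintype τ] {f : τ → σ} (hf : f.Bijective)
    {P : σ → ℝ} (E : (Fin d → σ) → Prop) :
    prodProb (fun s => P (f s)) (fun ω : Fin d → τ => E (f ∘ ω)) = prodProb P E := by
  classical
  simp only [prodProb, sum_filter]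
  exact Fintype.sum_equiv (Equiv.arrowCongr (Equiv.refl _) (Equiv.ofBijective f hf)) _ _
    fun ω => rfl

lemma card_wordSet_inter (ω : Fin d → Fin 2 × Fin 2) :
    (wordSet (fun i => (ω i).1) ∩ wordSet fun i => (ω i).2).card =
      #{i | (ω i).1 = 0 ∧ (ω i).2 = 0} := by
  congr 1; ext i; simp [wordSet]

lemma card_wordSet_sdiff_right (ω : Fin d → Fin 2 × Fin 2) :
    (wordSet (fun i => (ω i).2) \ wordSet fun i => (ω i).1).card =
      #{i | (ω i).2 = 0 ∧ ¬ (ω i).1 = 0} := by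
  congr 1; ext i; simp [wordSet]

lemma card_wordSet_sdiff_left (ω : Fin d → Fin 2 × Fin 2) :
    (wordSet (fun i => (ω i).1) \ wordSet fun i => (ω i).2).card =
      #{i | (ω i).1 = 0 ∧ ¬ (ω i).2 = 0} := by
  congr 1; ext i; simp [wordSet]

lemma card_wordSet_union_compl (ω : Fin d → Fin 2 × Fin 2) :
    (wordSet (fun i => (ω i).1) ∪ wordSet fun i => (ω i).2)ᶜ.card =
      #{i | ¬ (ω i).1 = 0 ∧ ¬ (ω i).2 = 0} := by
  congr 1; ext i; simp [wordSet]

lemma closeWord_of_correctable {ω : Fin d → Fin 4} (h : Correctable K A B ω) :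
    CloseWord (K + A) (K + B) K (![((0 : Fin 2), (0 : Fin 2)), (0, 1), (1, 0), (1, 1)] ∘ ω) := by
  set f : Fin 4 → Fin 2 × Fin 2 := ![(0, 0), (0, 1), (1, 0), (1, 1)] with hf
  have h0 := hits_eq_card (S := {0}) (f := f) (Q := fun s => s.1 = 0 ∧ s.2 = 0) (by decide) ω
  have h01 := hits_eq_card (S := {0, 1}) (f := f) (Q := fun s => s.1 = 0) (by decide) ω
  have h02 := hits_eq_card (S := {0, 2}) (f := f) (Q := fun s => s.2 = 0) (by decide) ω
  have h2 := hits_eq_card (S := {2}) (f := f) (Q := fun s => s.2 = 0 ∧ ¬ s.1 = 0) (by decide) ω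
  rcases h with ⟨e1, e2, e3⟩ | ⟨e1, e2, e3⟩
  · exact alwaysClose_add_add (by rw [card_wordSet_inter]; exact e1.trans_eq h0)
      (h01.ge.trans e2) (h02.ge.trans e3)
  · exact alwaysClose_add_remove (by rw [card_wordSet_sdiff_right]; exact h2.ge.trans e1)
      (h01.ge.trans e2) (e3.trans_eq h02)

lemma closeWord_of_correctable_swap {ω : Fin d → Fin 4} (h : Correctable K B A ω) :
    CloseWord (K + A) (K + B) K (![((0 : Fin 2), (0 : Fin 2)), (1, 0), (0, 1), (1, 1)] ∘ ω) := by
  set f : Fin 4 → Fin 2 × Fin 2 := ![(0, 0), (1, 0), (0, 1), (1, 1)] with hf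
  have h0 := hits_eq_card (S := {0}) (f := f) (Q := fun s => s.1 = 0 ∧ s.2 = 0) (by decide) ω
  have h01 := hits_eq_card (S := {0, 1}) (f := f) (Q := fun s => s.2 = 0) (by decide) ω
  have h02 := hits_eq_card (S := {0, 2}) (f := f) (Q := fun s => s.1 = 0) (by decide) ω
  have h2 := hits_eq_card (S := {2}) (f := f) (Q := fun s => s.1 = 0 ∧ ¬ s.2 = 0) (by decide) ω
  rcases h with ⟨e1, e2, e3⟩ | ⟨e1, e2, e3⟩
  · exact alwaysClose_add_add (by rw [card_wordSet_inter]; exact e1.trans_eq h0)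
      (h02.ge.trans e3) (h01.ge.trans e2)
  · exact alwaysClose_remove_add (by rw [card_wordSet_sdiff_left]; exact h2.ge.trans e1)
      (e3.trans_eq h02) (h01.ge.trans e2)

lemma card_filter_not_eq (p : Fin d → Prop) [DecidablePred p] :
    #{i | p i} + #{i | ¬ p i} = d := by
  simpa using card_filter_add_card_filter_not (s := (univ : Finset (Fin d))) p

lemma closeWord_of_correctable_compl (hd : d = K + A + B + C) {ω : Fin d → Fin 4}
    (h : Correctable C A B ω) :
    CloseWord (K + A) (K + B) K (![((1 : Fin 2), (1 : Fin 2)), (0, 1), (1, 0), (0, 0)] ∘ ω) := by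
  set f : Fin 4 → Fin 2 × Fin 2 := ![(1, 1), (0, 1), (1, 0), (0, 0)] with hf
  have h0 := hits_eq_card (S := {0}) (f := f) (Q := fun s => ¬ s.1 = 0 ∧ ¬ s.2 = 0) (by decide) ω
  have h01 := hits_eq_card (S := {0, 1}) (f := f) (Q := fun s => ¬ s.2 = 0) (by decide) ω
  have h02 := hits_eq_card (S := {0, 2}) (f := f) (Q := fun s => ¬ s.1 = 0) (by decide) ω
  have h2 := hits_eq_card (S := {2}) (f := f) (Q := fun s => s.2 = 0 ∧ ¬ s.1 = 0) (by decide) ω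
  have hX := card_filter_not_eq fun i => (f (ω i)).1 = 0
  have hY := card_filter_not_eq fun i => (f (ω i)).2 = 0
  have eX : (wordSet fun i => (f (ω i)).1).card = #{i | (f (ω i)).1 = 0} := rfl
  have eY : (wordSet fun i => (f (ω i)).2).card = #{i | (f (ω i)).2 = 0} := rfl
  rcases h with ⟨e1, e2, e3⟩ | ⟨e1, e2, e3⟩
  · refine alwaysClose_remove_remove (C := C) hd
      (by rw [card_wordSet_union_compl]; exact e1.trans_eq h0) ?_ ?_ <;>
    simp only [Function.comp_apply] <;> omega
  · refine alwaysClose_add_remove (by rw [card_wordSet_sdiff_right]; exact h2.ge.trans e1) ?_ ?_ <;>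
    simp only [Function.comp_apply] <;> omega

lemma closeWord_of_correctable_swap_compl (hd : d = K + A + B + C) {ω : Fin d → Fin 4}
    (h : Correctable C B A ω) :
    CloseWord (K + A) (K + B) K (![((1 : Fin 2), (1 : Fin 2)), (1, 0), (0, 1), (0, 0)] ∘ ω) := by
  set f : Fin 4 → Fin 2 × Fin 2 := ![(1, 1), (1, 0), (0, 1), (0, 0)] with hf
  have h0 := hits_eq_card (S := {0}) (f := f) (Q := fun s => ¬ s.1 = 0 ∧ ¬ s.2 = 0) (by decide) ω
  have h01 := hits_eq_card (S := {0, 1}) (f := f) (Q := fun s => ¬ s.1 = 0) (by decide) ω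
  have h02 := hits_eq_card (S := {0, 2}) (f := f) (Q := fun s => ¬ s.2 = 0) (by decide) ω
  have h2 := hits_eq_card (S := {2}) (f := f) (Q := fun s => s.1 = 0 ∧ ¬ s.2 = 0) (by decide) ω
  have hX := card_filter_not_eq fun i => (f (ω i)).1 = 0
  have hY := card_filter_not_eq fun i => (f (ω i)).2 = 0
  have eX : (wordSet fun i => (f (ω i)).1).card = #{i | (f (ω i)).1 = 0} := rfl
  have eY : (wordSet fun i => (f (ω i)).2).card = #{i | (f (ω i)).2 = 0} := rfl
  rcases h with ⟨e1, e2, e3⟩ | ⟨e1, e2, e3⟩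
  · refine alwaysClose_remove_remove (C := C) hd
      (by rw [card_wordSet_union_compl]; exact e1.trans_eq h0) ?_ ?_ <;>
    simp only [Function.comp_apply] <;> omega
  · refine alwaysClose_remove_add (by rw [card_wordSet_sdiff_left]; exact h2.ge.trans e1) ?_ ?_ <;>
    simp only [Function.comp_apply] <;> omega

/-- The four symmetric versions of `prodProb_correctable`, for the distribution of pairs: it
suffices that the larger of `A` and `B` is large and not much smaller than `K` or than `C`. -/
lemma prodProb_closeWord {wq wu w₁ L : ℝ} (hd : d = K + A + B + C) (hK : 1 ≤ K) (hC : 1 ≤ C)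
    (hKC : A * B ≤ K * C) (hq : ((K + A : ℕ) : ℝ) = wq * d) (hu : ((K + B : ℕ) : ℝ) = wu * d)
    (h1 : (K : ℝ) = w₁ * d) (hL : 1 ≤ L) (hmin : ((min K C : ℕ) : ℝ) ≤ L * (max A B : ℕ))
    (hmax : 3600 * (1 + L) ≤ (max A B : ℕ)) :
    Real.exp (-(5764400 + 5200 * (1 + L))) / 4 ≤
      prodProb (fun s : Fin 2 × Fin 2 => pairDist wq wu w₁ s.1 s.2)
        (CloseWord (d := d) (K + A) (K + B) K) := by
  have hdpos : (0 : ℝ) < d := by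
    rw [hd]; push_cast
    have : (1 : ℝ) ≤ K := by exact_mod_cast hK
    positivity
  have hd' : (d : ℝ) = K + A + B + C := by exact_mod_cast hd
  push_cast at hq hu
  have pK : pairDist wq wu w₁ 0 0 = K / d := by
    rw [eq_div_iff hdpos.ne']; simp [pairDist]; linarith
  have pA : pairDist wq wu w₁ 0 1 = A / d := by
    rw [eq_div_iff hdpos.ne']; simp [pairDist]; linarith
  have pB : pairDist wq wu w₁ 1 0 = B / d := by
    rw [eq_div_iff hdpos.ne']; simp [pairDist]; linarith
  have pC : pairDist wq wu w₁ 1 1 = C / d := by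
    rw [eq_div_iff hdpos.ne']; simp [pairDist]; linarith
  have key : ∀ (f : Fin 4 → Fin 2 × Fin 2) (n : Fin 4 → ℝ) (E : (Fin d → Fin 4) → Prop),
      f.Bijective → (∀ s, pairDist wq wu w₁ (f s).1 (f s).2 = n s / d) →
      (∀ ω, E ω → CloseWord (d := d) (K + A) (K + B) K (f ∘ ω)) → (∀ s, 0 ≤ n s) →
      Real.exp (-(5764400 + 5200 * (1 + L))) / 4 ≤ prodProb (fun s => n s / d) E →
      Real.exp (-(5764400 + 5200 * (1 + L))) / 4 ≤
        prodProb (fun s : Fin 2 × Fin 2 => pairDist wq wu w₁ s.1 s.2)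
          (CloseWord (d := d) (K + A) (K + B) K) := by
    intro f n E hf hn hE hn0 h
    rw [← prodProb_comp hf]
    simp only [hn]
    exact h.trans (prodProb_mono (fun s => div_nonneg (hn0 s) hdpos.le) hE)
  rcases le_total B A with hBA | hBA
  · rw [max_eq_left hBA] at hmin hmax
    rcases le_total K C with hc | hc
    · rw [min_eq_left hc] at hmin
      refine key ![(0, 0), (0, 1), (1, 0), (1, 1)] ![(K : ℝ), A, B, C] _ (by decide) ?_
        (fun ω hω => closeWord_of_correctable hω) ?_
        (prodProb_correctable hd hK hC hBA hKC hL hmin hmax)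
      · intro s; fin_cases s
        exacts [pK, pA, pB, pC]
      · intro s; fin_cases s <;> simp
    · rw [min_eq_right hc] at hmin
      refine key ![(1, 1), (0, 1), (1, 0), (0, 0)] ![(C : ℝ), A, B, K] _ (by decide) ?_
        (fun ω hω => closeWord_of_correctable_compl hd hω) ?_
        (prodProb_correctable (by omega) hC hK hBA (by rwa [mul_comm C]) hL hmin hmax)
      · intro s; fin_cases s
        exacts [pC, pA, pB, pK]
      · intro s; fin_cases s <;> simp
  · rw [max_eq_right hBA] at hmin hmax
    rcases le_total K C with hc | hc
    · rw [min_eq_left hc] at hmin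
      refine key ![(0, 0), (1, 0), (0, 1), (1, 1)] ![(K : ℝ), B, A, C] _ (by decide) ?_
        (fun ω hω => closeWord_of_correctable_swap hω) ?_
        (prodProb_correctable (by omega) hK hC hBA (by rwa [mul_comm B]) hL hmin hmax)
      · intro s; fin_cases s
        exacts [pK, pB, pA, pC]
      · intro s; fin_cases s <;> simp
    · rw [min_eq_right hc] at hmin
      refine key ![(1, 1), (1, 0), (0, 1), (0, 0)] ![(C : ℝ), B, A, K] _ (by decide) ?_
        (fun ω hω => closeWord_of_correctable_swap_compl hd hω) ?_
        (prodProb_correctable (by omega) hC hK hBA (by rwa [mul_comm B, mul_comm C]) hL hmin hmax)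
      · intro s; fin_cases s
        exacts [pC, pB, pA, pK]
      · intro s; fin_cases s <;> simp

end Correction

section Slices

variable {d : ℕ}

lemma exists_perm_map_eq {q q₀ : Finset (Fin d)} (h : q.card = q₀.card) :
    ∃ τ : Equiv.Perm (Fin d), q.map τ.toEmbedding = q₀ := by
  let e : {x // x ∈ q} ≃ {x // x ∈ q₀} := Finset.equivOfCardEq h
  refine ⟨e.extendSubtype, eq_of_subset_of_card_le ?_ (by rw [card_map, h])⟩
  intro x hx
  obtain ⟨y, hy, rfl⟩ := mem_map.1 hx
  exact e.extendSubtype_mem y hy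

/-- The average of `f` over the sets of size `k`. -/
noncomputable def sliceAvg (k : ℕ) (f : Finset (Fin d) → ℝ) : ℝ :=
  (∑ q ∈ powersetCard k univ, f q) / (powersetCard k (univ : Finset (Fin d))).card

lemma card_slice_pos {k : ℕ} (hk : k ≤ d) :
    (0 : ℝ) < (powersetCard k (univ : Finset (Fin d))).card := by
  rw [Nat.cast_pos, card_pos]
  exact powersetCard_nonempty.2 (by simpa using hk)

lemma sliceAvg_nonneg {k : ℕ} {f : Finset (Fin d) → ℝ} (hf : ∀ q, 0 ≤ f q) :
    0 ≤ sliceAvg k f :=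
  div_nonneg (sum_nonneg fun q _ => hf q) (Nat.cast_nonneg _)

/-- A permutation invariant weight is uniform on the sets of size `k`. -/
lemma sum_slice_mul_invariant {k : ℕ} (hk : k ≤ d) {c : Finset (Fin d) → ℝ}
    (hc : ∀ (τ : Equiv.Perm (Fin d)) q, c (q.map τ.toEmbedding) = c q)
    (f : Finset (Fin d) → ℝ) :
    ∑ q ∈ powersetCard k univ, f q * c q =
      (∑ q ∈ powersetCard k univ, c q) * sliceAvg k f := by
  obtain ⟨q₀, hq₀⟩ : (powersetCard k (univ : Finset (Fin d))).Nonempty :=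
    powersetCard_nonempty.2 (by simpa using hk)
  have h : ∀ q ∈ powersetCard k (univ : Finset (Fin d)), c q = c q₀ := by
    intro q hq
    obtain ⟨τ, hτ⟩ := exists_perm_map_eq
      ((mem_powersetCard_univ.1 hq).trans (mem_powersetCard_univ.1 hq₀).symm)
    rw [← hc τ q, hτ]
  have h2 := (card_slice_pos hk).ne'
  rw [sum_congr rfl h, sum_congr rfl fun q hq => by rw [h q hq], ← sum_mul, sum_const,
    nsmul_eq_mul, sliceAvg]
  field_simp

/-- The average of `f` over the corrections of `X` to size `k`. -/
noncomputable def nearAvg (k : ℕ) (f : Finset (Fin d) → ℝ) (X : Finset (Fin d)) : ℝ :=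
  (∑ q ∈ nearSets k X, f q) / (nearSets k X).card

lemma card_nearSets_pos {k : ℕ} (hk : k ≤ d) (X : Finset (Fin d)) :
    (0 : ℝ) < (nearSets k X).card :=
  Nat.cast_pos.2 (card_pos.2 (nearSets_nonempty hk X))

lemma nearAvg_mem_Icc {k : ℕ} {f : Finset (Fin d) → ℝ} (hf : ∀ q, f q ∈ Set.Icc (0 : ℝ) 1)
    (X : Finset (Fin d)) : nearAvg k f X ∈ Set.Icc (0 : ℝ) 1 := by
  refine ⟨div_nonneg (sum_nonneg fun q _ => (hf q).1) (Nat.cast_nonneg _),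
    div_le_one_of_le₀ ?_ (Nat.cast_nonneg _)⟩
  simpa using sum_le_sum fun q (_ : q ∈ nearSets k X) => (hf q).2

lemma mem_nearSets_map {k : ℕ} {X q : Finset (Fin d)} (τ : Equiv.Perm (Fin d)) :
    q.map τ.toEmbedding ∈ nearSets k (X.map τ.toEmbedding) ↔ q ∈ nearSets k X := by
  simp only [mem_nearSets, card_map, map_subset_map]

lemma card_nearSets_map (k : ℕ) (X : Finset (Fin d)) (τ : Equiv.Perm (Fin d)) :
    (nearSets k (X.map τ.toEmbedding)).card = (nearSets k X).card := by
  refine (card_equiv (Equiv.finsetCongr τ) fun q => ?_).symm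
  rw [Equiv.finsetCongr_apply, mem_nearSets_map]

/-- Correcting the size of a random set with independent elements gives a uniform set of size
`k`, by symmetry. -/
lemma sum_nearAvg {k : ℕ} (hk : k ≤ d) {p : Fin 2 → ℝ} (hp : ∑ j, p j = 1)
    (f : Finset (Fin d) → ℝ) :
    ∑ x : Fin d → Fin 2, (∏ i, p (x i)) * nearAvg k f (wordSet x) = sliceAvg k f := by
  set c : Finset (Fin d) → ℝ := fun q => ∑ x : Fin d → Fin 2, (∏ i, p (x i)) *
    (if q ∈ nearSets k (wordSet x) then ((nearSets k (wordSet x)).card : ℝ)⁻¹ else 0) with hc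
  have hswap : ∀ f : Finset (Fin d) → ℝ,
      ∑ x : Fin d → Fin 2, (∏ i, p (x i)) * nearAvg k f (wordSet x) =
        ∑ q ∈ powersetCard k univ, f q * c q := by
    intro f
    simp only [hc, mul_sum]
    rw [sum_comm]
    refine sum_congr rfl fun x _ => ?_
    rw [nearAvg, div_eq_mul_inv, sum_mul, mul_sum]
    have hsub : nearSets k (wordSet x) ⊆ powersetCard k univ := fun q hq =>
      mem_powersetCard_univ.2 (mem_nearSets.1 hq).1
    rw [← sum_subset hsub fun q _ hq => by simp [hq]]
    refine sum_congr rfl fun q hq => ?_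
    rw [if_pos hq]
    ring
  have hinv : ∀ (τ : Equiv.Perm (Fin d)) q, c (q.map τ.toEmbedding) = c q := by
    intro τ q
    refine (Fintype.sum_equiv (Equiv.arrowCongr τ (Equiv.refl (Fin 2))) _ _ fun x => ?_).symm
    have hw : wordSet (Equiv.arrowCongr τ (Equiv.refl (Fin 2)) x) =
        (wordSet x).map τ.toEmbedding := by
      ext i
      simp [wordSet, mem_map_equiv]
    simp only [hw, mem_nearSets_map, card_nearSets_map]
    congr 1
    exact Fintype.prod_equiv τ _ _ fun i => by simp
  have h1 : ∑ q ∈ powersetCard k univ, c q = 1 := by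
    have h2 := hswap fun _ => 1
    simp only [one_mul] at h2
    rw [← h2]
    have : ∀ x : Fin d → Fin 2, nearAvg k (fun _ => (1 : ℝ)) (wordSet x) = 1 := fun x => by
      have := (card_nearSets_pos hk (wordSet x)).ne'
      simp [nearAvg, this]
    simp only [this, mul_one]
    rw [sum_prod_apply, hp, one_pow]
  rw [hswap, sum_slice_mul_invariant hk hinv, h1, one_mul]

end Slices

/-! ### Cost and success of a random data structure -/

section Structures

lemma pmfExp_sum {α ι : Type} [Fintype α] (p : PMF α) (s : Finset ι) (f : ι → α → ℝ) :
    pmfExp p (fun a => ∑ i ∈ s, f i a) = ∑ i ∈ s, pmfExp p (f i) := by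
  simp only [pmfExp, mul_sum]
  exact sum_comm

lemma pmfExp_mul {α : Type} [Fintype α] (p : PMF α) (c : ℝ) (f : α → ℝ) :
    pmfExp p (fun a => c * f a) = c * pmfExp p f := by
  simp only [pmfExp, mul_sum]
  exact sum_congr rfl fun a _ => by ring

lemma pmfExp_mono {α : Type} [Fintype α] (p : PMF α) {f g : α → ℝ} (h : ∀ a, f a ≤ g a) :
    pmfExp p f ≤ pmfExp p g :=
  sum_le_sum fun a _ => mul_le_mul_of_nonneg_left (h a) ENNReal.toReal_nonneg

lemma pmfExp_add {α : Type} [Fintype α] (p : PMF α) (f g : α → ℝ) :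
    pmfExp p (fun a => f a + g a) = pmfExp p f + pmfExp p g := by
  simp only [pmfExp, mul_add, sum_add_distrib]

variable {d m : ℕ}

namespace ListOfPoints

/-- Whether the list `i` is scanned for the query `q`, as a number. -/
def scan (D : ListOfPoints d m) (i : Fin m) (q : Finset (Fin d)) : ℝ :=
  if i ∈ D.I q then 1 else 0

/-- Whether the point `y` belongs to `A i`, as a number. -/
def store (D : ListOfPoints d m) (i : Fin m) (y : Finset (Fin d)) : ℝ :=
  if y ∈ D.A i then 1 else 0

lemma scan_mem (D : ListOfPoints d m) (i : Fin m) (q : Finset (Fin d)) :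
    D.scan i q ∈ Set.Icc (0 : ℝ) 1 := by
  unfold scan; split_ifs <;> simp

lemma store_mem (D : ListOfPoints d m) (i : Fin m) (q : Finset (Fin d)) :
    D.store i q ∈ Set.Icc (0 : ℝ) 1 := by
  unfold store; split_ifs <;> simp

lemma Succeeds.one_le {D : ListOfPoints d m} {P : Multiset (Finset (Fin d))}
    {q y : Finset (Fin d)} (h : D.Succeeds P q y) : 1 ≤ ∑ i, D.scan i q * D.store i y := by
  obtain ⟨i, hi, hy⟩ := h
  refine le_trans ?_ (single_le_sum (fun j _ => mul_nonneg (D.scan_mem j q).1 (D.store_mem j y).1)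
    (mem_univ i))
  simp [scan, store, hi, (Multiset.mem_filter.1 hy).2]

lemma sum_store_le_card_lists (D : ListOfPoints d m) {n : ℕ} (i : Fin m)
    (x : Finset (Fin d) × Finset (Fin d) × (Fin (n - 1) → Finset (Fin d))) :
    ∑ j, D.store i (x.2.2 j) ≤ ((D.lists (instanceDataset x) i).card : ℝ) := by
  have h1 : (Multiset.filter (fun y => y ∈ D.A i)
      ((univ : Finset (Fin (n - 1))).val.map x.2.2)).card ≤
      (D.lists (instanceDataset x) i).card :=
    Multiset.card_le_card (Multiset.filter_le_filter _ (Multiset.le_cons_self _ _))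
  refine le_trans (le_of_eq ?_) (Nat.cast_le.2 h1)
  rw [Multiset.filter_map, Multiset.card_map]
  simp only [store]
  rw [sum_boole]
  rfl

lemma le_space (D : ListOfPoints d m) {n : ℕ}
    (x : Finset (Fin d) × Finset (Fin d) × (Fin (n - 1) → Finset (Fin d))) :
    ∑ i, (1 + ∑ j, D.store i (x.2.2 j)) ≤ (D.space (instanceDataset x) : ℝ) := by
  rw [space, sum_add_distrib]
  push_cast
  refine add_le_add (by simp) (sum_le_sum fun i _ => D.sum_store_le_card_lists i x)

lemma le_queryTime (D : ListOfPoints d m) {n : ℕ}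
    (x : Finset (Fin d) × Finset (Fin d) × (Fin (n - 1) → Finset (Fin d))) :
    ∑ i, (D.scan i x.1 + ∑ j, D.scan i x.1 * D.store i (x.2.2 j)) ≤
      (D.queryTime (instanceDataset x) x.1 : ℝ) := by
  rw [queryTime, sum_add_distrib]
  push_cast
  refine add_le_add (by simp [scan]) ?_
  rw [← sum_subset (subset_univ (D.I x.1)) fun i _ hi => by simp [scan, hi]]
  refine sum_le_sum fun i hi => ?_
  simp only [scan, if_pos hi, one_mul]
  exact D.sum_store_le_card_lists i x

end ListOfPoints

/-- The planted pairs `(q, y)`. -/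
def plantedPairs (d kq ku k₁ : ℕ) : Finset (Finset (Fin d) × Finset (Fin d)) :=
  univ.filter fun x => x.1.card = kq ∧ x.2.card = ku ∧ (x.1 ∩ x.2).card = k₁

lemma sum_randomInstances {n kq ku k₁ : ℕ} (F : Finset (Fin d) → ℝ)
    (G : (Fin (n - 1) → Finset (Fin d)) → ℝ) :
    ∑ x ∈ randomInstances n d kq ku k₁, F x.1 * G x.2.2 =
      (∑ x ∈ plantedPairs d kq ku k₁, F x.1) *
        ∑ Y ∈ Fintype.piFinset fun _ => powersetCard ku univ, G Y := by
  rw [sum_mul_sum, ← sum_product']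
  refine sum_equiv (Equiv.prodAssoc _ _ _).symm (fun x => ?_) fun x _ => rfl
  simp [randomInstances, plantedPairs, Fintype.mem_piFinset, and_assoc]

variable {kq ku k₁ : ℕ}

lemma exists_planted (h₁ : k₁ ≤ kq) (hu : k₁ ≤ ku) (hd : kq + ku ≤ d + k₁)
    {y : Finset (Fin d)} (hy : y.card = ku) :
    ∃ q : Finset (Fin d), q.card = kq ∧ (q ∩ y).card = k₁ := by
  obtain ⟨a, ha, hac⟩ := exists_subset_card_eq (hu.trans hy.ge)
  have hyc : kq - k₁ ≤ yᶜ.card := by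
    rw [card_compl, hy, Fintype.card_fin]; omega
  obtain ⟨b, hb, hbc⟩ := exists_subset_card_eq hyc
  have hdisj : Disjoint b y := disjoint_left.2 fun i hi => mem_compl.1 (hb hi)
  refine ⟨a ∪ b, ?_, ?_⟩
  · rw [card_union_of_disjoint (hdisj.symm.mono_left ha)]; omega
  · rw [union_inter_distrib_right, inter_eq_left.2 ha, disjoint_iff_inter_eq_empty.1 hdisj,
      union_empty, hac]

/-- The query of a random planted pair is uniform, by symmetry. -/
lemma sum_plantedPairs (hk : kq ≤ d) (F : Finset (Fin d) → ℝ) :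
    ∑ x ∈ plantedPairs d kq ku k₁, F x.1 = (plantedPairs d kq ku k₁).card * sliceAvg kq F := by
  set c : Finset (Fin d) → ℝ := fun q =>
    ((univ.filter fun y : Finset (Fin d) => y.card = ku ∧ (q ∩ y).card = k₁).card : ℝ) with hc
  have hsum : ∀ F : Finset (Fin d) → ℝ, ∑ x ∈ plantedPairs d kq ku k₁, F x.1 =
      ∑ q ∈ powersetCard kq univ, F q * c q := by
    intro F
    have : powersetCard kq (univ : Finset (Fin d)) = univ.filter fun q => q.card = kq := by
      ext q; simp
    rw [plantedPairs, sum_filter, Fintype.sum_prod_type, this, sum_filter]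
    refine sum_congr rfl fun q _ => ?_
    split_ifs with h
    · simp [h, hc, ← sum_filter, mul_comm]
    · simp [h]
  have hinv : ∀ (τ : Equiv.Perm (Fin d)) q, c (q.map τ.toEmbedding) = c q := by
    intro τ q
    refine Nat.cast_inj.2 (card_equiv (Equiv.finsetCongr τ) fun y => ?_).symm
    simp [Equiv.finsetCongr_apply, ← map_inter]
  have h1 := hsum fun _ => 1
  simp only [one_mul, sum_const, nsmul_eq_mul, mul_one] at h1
  rw [hsum, sum_slice_mul_invariant hk hinv, h1]

/-- In a random instance the query and each further point are uniform and independent. -/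
lemma avg_randomInstances {n : ℕ} (h₁ : k₁ ≤ kq) (hu : k₁ ≤ ku) (hd : kq + ku ≤ d + k₁)
    (F G : Finset (Fin d) → ℝ) (j : Fin (n - 1)) :
    (∑ x ∈ randomInstances n d kq ku k₁, F x.1 * G (x.2.2 j)) /
      (randomInstances n d kq ku k₁).card = sliceAvg kq F * sliceAvg ku G := by
  have hku : ku ≤ d := by omega
  have h0 := sum_randomInstances (d := d) (n := n) (kq := kq) (ku := ku) (k₁ := k₁)
    (fun _ => 1) fun _ => 1
  simp only [mul_one, sum_const, nsmul_eq_mul, Fintype.card_piFinset_const] at h0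
  have h2 := sum_randomInstances (d := d) (n := n) (kq := kq) (ku := ku) (k₁ := k₁)
    F fun Y => G (Y j)
  have hn : n - 1 = n - 1 - 1 + 1 := by have := j.2; omega
  have hP : (0 : ℝ) < (plantedPairs d kq ku k₁).card := by
    obtain ⟨y, -, hy⟩ := exists_subset_card_eq (s := (univ : Finset (Fin d))) (n := ku)
      (by simpa using hku)
    obtain ⟨q, hq, hqy⟩ := exists_planted h₁ hu hd hy
    exact Nat.cast_pos.2 (card_pos.2 ⟨(q, y), by simp [plantedPairs, hq, hy, hqy]⟩)
  have hS := card_slice_pos hku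
  rw [h2, h0, sum_plantedPairs (by omega), Fintype.sum_piFinset_apply, Fintype.card_fin]
  simp only [nsmul_eq_mul]
  have hG : sliceAvg ku G = (∑ y ∈ powersetCard ku univ, G y) /
      (powersetCard ku (univ : Finset (Fin d))).card := rfl
  rw [hG]
  set S := (powersetCard ku (univ : Finset (Fin d))).card
  have e : ((S ^ (n - 1) : ℕ) : ℝ) = (S : ℝ) ^ (n - 1 - 1) * S := by
    rw [← pow_succ, ← hn]; push_cast; rfl
  clear hn
  rw [e]
  push_cast
  field_simp

lemma avg_randomInstances_query {n : ℕ} (h₁ : k₁ ≤ kq) (hu : k₁ ≤ ku) (hd : kq + ku ≤ d + k₁)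
    (hn : 2 ≤ n) (F : Finset (Fin d) → ℝ) :
    (∑ x ∈ randomInstances n d kq ku k₁, F x.1) /
      (randomInstances n d kq ku k₁).card = sliceAvg kq F := by
  have := avg_randomInstances (n := n) h₁ hu hd F (fun _ => 1) ⟨0, by omega⟩
  have h2 : sliceAvg ku (fun _ : Finset (Fin d) => (1 : ℝ)) = 1 := by
    have := (card_slice_pos (d := d) (k := ku) (by omega)).ne'
    simp only [sliceAvg, sum_const, nsmul_eq_mul, mul_one]
    exact div_self this
  simpa [h2] using this

lemma expectedQueryTime_ge {n : ℕ} (h₁ : k₁ ≤ kq) (hu : k₁ ≤ ku) (hd : kq + ku ≤ d + k₁)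
    (hn : 2 ≤ n) (p : PMF (ListOfPoints d m)) :
    pmfExp p (fun D => ∑ i, sliceAvg kq (D.scan i) * (1 + (n - 1) * sliceAvg ku (D.store i))) ≤
      expectedQueryTime p n kq ku k₁ := by
  refine pmfExp_mono p fun D => ?_
  refine le_trans (le_of_eq ?_) (div_le_div_of_nonneg_right (sum_le_sum fun x _ =>
    D.le_queryTime x) (Nat.cast_nonneg _))
  rw [sum_comm, sum_div]
  refine sum_congr rfl fun i _ => ?_
  rw [sum_add_distrib, add_div, avg_randomInstances_query h₁ hu hd hn, sum_comm, sum_div]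
  simp only [avg_randomInstances h₁ hu hd, sum_const, card_univ, Fintype.card_fin, nsmul_eq_mul]
  rw [Nat.cast_sub (by omega)]
  push_cast
  ring

lemma expectedSpace_ge {n : ℕ} (h₁ : k₁ ≤ kq) (hu : k₁ ≤ ku) (hd : kq + ku ≤ d + k₁)
    (hn : 2 ≤ n) (p : PMF (ListOfPoints d m)) :
    pmfExp p (fun D => ∑ i, (1 + (n - 1) * sliceAvg ku (D.store i))) ≤
      expectedSpace p n kq ku k₁ := by
  refine pmfExp_mono p fun D => ?_
  refine le_trans (le_of_eq ?_) (div_le_div_of_nonneg_right (sum_le_sum fun x _ =>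
    D.le_space x) (Nat.cast_nonneg _))
  rw [sum_comm, sum_div]
  refine sum_congr rfl fun i _ => ?_
  have h2 : sliceAvg kq (fun _ : Finset (Fin d) => (1 : ℝ)) = 1 := by
    have := (card_slice_pos (d := d) (k := kq) (by omega)).ne'
    simp only [sliceAvg, sum_const, nsmul_eq_mul, mul_one]
    exact div_self this
  have h3 := avg_randomInstances (n := n) h₁ hu hd (fun _ : Finset (Fin d) => (1 : ℝ)) (D.store i)
  simp only [one_mul, h2] at h3
  rw [sum_add_distrib, add_div, avg_randomInstances_query h₁ hu hd hn (fun _ => 1), h2, sum_comm,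
    sum_div]
  simp only [h3, sum_const, card_univ, Fintype.card_fin, nsmul_eq_mul]
  rw [Nat.cast_sub (by omega)]
  push_cast
  ring

/-- Success on a single pair, from the guarantee for the dataset of `n` copies of the point. -/
lemma SolvesGapSS.le_pmfExp {n : ℕ} {γ : ℝ} {p : PMF (ListOfPoints d m)}
    (h : SolvesGapSS p n kq ku k₁ γ) (hn : n ≠ 0) {q y : Finset (Fin d)} (hq : q.card = kq)
    (hy : y.card = ku) (hqy : k₁ ≤ (q ∩ y).card) :
    γ ≤ pmfExp p fun D => ∑ i, D.scan i q * D.store i y := by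
  refine (h (Multiset.replicate n y) q (Multiset.card_replicate _ _)
    (fun z hz => by rw [Multiset.eq_of_mem_replicate hz, hy]) hq y
    (Multiset.mem_replicate.2 ⟨hn, rfl⟩) hqy).trans (pmfExp_mono p fun D => ?_)
  by_cases hD : D.Succeeds (Multiset.replicate n y) q y
  · rw [Set.indicator_of_mem (show D ∈ {D : ListOfPoints d m |
      D.Succeeds (Multiset.replicate n y) q y} from hD)]
    exact hD.one_le
  · rw [Set.indicator_of_notMem (show D ∉ {D : ListOfPoints d m |
      D.Succeeds (Multiset.replicate n y) q y} from hD)]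
    exact sum_nonneg fun i _ => mul_nonneg (D.scan_mem i q).1 (D.store_mem i y).1

lemma le_sliceAvg {k : ℕ} (hk : k ≤ d) {f : Finset (Fin d) → ℝ} {γ : ℝ}
    (h : ∀ q : Finset (Fin d), q.card = k → γ ≤ f q) : γ ≤ sliceAvg k f := by
  rw [sliceAvg, le_div_iff₀ (card_slice_pos hk), mul_comm, ← nsmul_eq_mul]
  exact card_nsmul_le_sum _ _ _ fun q hq => h q (mem_powersetCard_univ.1 hq)

lemma pmfExp_sum_sliceAvg (p : PMF (ListOfPoints d m)) (k : ℕ)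
    (f : ListOfPoints d m → Fin m → Finset (Fin d) → ℝ) :
    pmfExp p (fun D => ∑ i, sliceAvg k (f D i)) =
      sliceAvg k fun q => pmfExp p fun D => ∑ i, f D i q := by
  simp only [sliceAvg]
  rw [← pmfExp_sum, div_eq_inv_mul, ← pmfExp_mul]
  congr 1
  funext D
  rw [← sum_div, sum_comm, div_eq_inv_mul]

lemma SolvesGapSS.le_scan {n : ℕ} {γ : ℝ} {p : PMF (ListOfPoints d m)}
    (h : SolvesGapSS p n kq ku k₁ γ) (hn : n ≠ 0) (h₁ : k₁ ≤ kq) (hu : k₁ ≤ ku)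
    (hd : kq + ku ≤ d + k₁) : γ ≤ pmfExp p fun D => ∑ i, sliceAvg kq (D.scan i) := by
  rw [pmfExp_sum_sliceAvg]
  refine le_sliceAvg (by omega) fun q hq => ?_
  obtain ⟨y, hy, hqy⟩ := exists_planted hu h₁ (by omega) hq
  refine (h.le_pmfExp hn hq hy (by rw [inter_comm, hqy])).trans (pmfExp_mono p fun D =>
    sum_le_sum fun i _ => mul_le_of_le_one_right (D.scan_mem i q).1 (D.store_mem i y).2)

lemma SolvesGapSS.le_store {n : ℕ} {γ : ℝ} {p : PMF (ListOfPoints d m)}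
    (h : SolvesGapSS p n kq ku k₁ γ) (hn : n ≠ 0) (h₁ : k₁ ≤ kq) (hu : k₁ ≤ ku)
    (hd : kq + ku ≤ d + k₁) : γ ≤ pmfExp p fun D => ∑ i, sliceAvg ku (D.store i) := by
  rw [pmfExp_sum_sliceAvg]
  refine le_sliceAvg (by omega) fun y hy => ?_
  obtain ⟨q, hq, hqy⟩ := exists_planted h₁ hu (by omega) hy
  refine (h.le_pmfExp hn hq hy hqy.ge).trans (pmfExp_mono p fun D =>
    sum_le_sum fun i _ => mul_le_of_le_one_left (D.store_mem i y).1 (D.scan_mem i q).2)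

end Structures

/-! ### The trade-off for one instance size -/

section Tradeoff

variable {d m n kq ku k₁ : ℕ}

lemma SolvesGapSS.le_nearAvg {γ : ℝ} {p : PMF (ListOfPoints d m)}
    (h : SolvesGapSS p n kq ku k₁ γ) (hn : n ≠ 0) (hkq : kq ≤ d) (hku : ku ≤ d)
    {X Y : Finset (Fin d)} (hXY : AlwaysClose kq ku k₁ X Y) :
    γ ≤ pmfExp p fun D => ∑ i, nearAvg kq (D.scan i) X * nearAvg ku (D.store i) Y := by
  have hX := card_nearSets_pos hkq X
  have hY := card_nearSets_pos hku Y
  have e : ∀ D : ListOfPoints d m, ∑ i, nearAvg kq (D.scan i) X * nearAvg ku (D.store i) Y =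
      ((nearSets kq X).card * (nearSets ku Y).card : ℝ)⁻¹ *
        ∑ q ∈ nearSets kq X, ∑ y ∈ nearSets ku Y, ∑ i, D.scan i q * D.store i y := by
    intro D
    simp only [nearAvg, div_mul_div_comm, sum_mul_sum]
    rw [← sum_div, div_eq_inv_mul, sum_comm]
    congr 1
    exact sum_congr rfl fun q _ => sum_comm
  simp only [e]
  rw [pmfExp_mul, pmfExp_sum]
  simp only [pmfExp_sum p (nearSets ku Y)]
  rw [inv_mul_eq_div, le_div_iff₀ (mul_pos hX hY)]
  have : ∑ q ∈ nearSets kq X, ∑ y ∈ nearSets ku Y, γ ≤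
      ∑ q ∈ nearSets kq X, ∑ y ∈ nearSets ku Y,
        pmfExp p fun D => ∑ i, D.scan i q * D.store i y :=
    sum_le_sum fun q hq => sum_le_sum fun y hy =>
      h.le_pmfExp hn (mem_nearSets.1 hq).1 (mem_nearSets.1 hy).1 (hXY q hq y hy)
  simp only [sum_const, nsmul_eq_mul] at this
  linarith

/-- One list: the probability that it is scanned for `q` and stores `y`, for a pair corrected
from independent coordinates. -/
lemma sum_pair_le {wq wu w₁ α β : ℝ} (hw : GapParams wq wu w₁) (hα : α ∈ Set.Icc (0 : ℝ) 1)
    (hβ : β ∈ Set.Icc (0 : ℝ) 1) (hkq : kq ≤ d) (hku : ku ≤ d)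
    (hD : ∀ tq tu T, Feasible (pairDist wq wu w₁) tq tu T →
      α * klBinary tq wq + β * klBinary tu wu ≤ klMatrix T (pairDist wq wu w₁))
    {f g : Finset (Fin d) → ℝ} (hf : ∀ q, f q ∈ Set.Icc (0 : ℝ) 1)
    (hg : ∀ y, g y ∈ Set.Icc (0 : ℝ) 1) :
    ∑ ω : Fin d → Fin 2 × Fin 2, (∏ i, pairDist wq wu w₁ (ω i).1 (ω i).2) *
      (nearAvg kq f (wordSet fun i => (ω i).1) * nearAvg ku g (wordSet fun i => (ω i).2)) ≤
      sliceAvg kq f ^ α * sliceAvg ku g ^ β := by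
  have hq1 : ∀ j, 0 ≤ ![wq, 1 - wq] j := by
    intro j; fin_cases j
    exacts [hw.q_nonneg, sub_nonneg.2 hw.q_le]
  have hu1 : ∀ j, 0 ≤ ![wu, 1 - wu] j := by
    intro j; fin_cases j
    exacts [hw.u_nonneg, sub_nonneg.2 hw.u_le]
  have key := pair_ineq_pi hw.pairDist_nonneg hq1 hu1
    (fun F G hF hG => pair_ineq hw.q_mem hw.u_mem hα.1 hβ.1 hw.pairDist_nonneg hD hF hG) d
    (fun x => nearAvg kq f (wordSet x)) (fun y => nearAvg ku g (wordSet y))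
    (fun x => (nearAvg_mem_Icc hf _).1) (fun y => (nearAvg_mem_Icc hg _).1)
  rw [sum_nearAvg hkq (by simp [Fin.sum_univ_two]),
    sum_nearAvg hku (by simp [Fin.sum_univ_two])] at key
  refine le_trans ?_ key
  rw [← Fintype.sum_prod_type']
  refine le_trans (le_of_eq (Fintype.sum_equiv (Equiv.arrowProdEquivProdArrow (Fin d)
    (fun _ => Fin 2) fun _ => Fin 2) _ (fun z => (∏ i, pairDist wq wu w₁ (z.1 i) (z.2 i)) *
      (nearAvg kq f (wordSet z.1) * nearAvg ku g (wordSet z.2))) fun ω => rfl))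
    (sum_le_sum fun z _ => ?_)
  refine mul_le_mul_of_nonneg_left ?_ (prod_nonneg fun i _ => hw.pairDist_nonneg _ _)
  obtain ⟨f0, f1⟩ := nearAvg_mem_Icc (k := kq) hf (wordSet z.1)
  obtain ⟨g0, g1⟩ := nearAvg_mem_Icc (k := ku) hg (wordSet z.2)
  exact mul_le_mul (Real.self_le_rpow_of_le_one f0 f1 hα.2)
    (Real.self_le_rpow_of_le_one g0 g1 hβ.2) g0 (Real.rpow_nonneg f0 _)

/-- The success guarantee, averaged over corrected pairs and bounded list by list. -/
lemma SolvesGapSS.le_sum_rpow {γ : ℝ} {p : PMF (ListOfPoints d m)}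
    (h : SolvesGapSS p n kq ku k₁ γ) (hn : n ≠ 0) (hkq : kq ≤ d) (hku : ku ≤ d)
    {wq wu w₁ α β : ℝ} (hw : GapParams wq wu w₁) (hα : α ∈ Set.Icc (0 : ℝ) 1)
    (hβ : β ∈ Set.Icc (0 : ℝ) 1)
    (hD : ∀ tq tu T, Feasible (pairDist wq wu w₁) tq tu T →
      α * klBinary tq wq + β * klBinary tu wu ≤ klMatrix T (pairDist wq wu w₁)) :
    γ * prodProb (fun s : Fin 2 × Fin 2 => pairDist wq wu w₁ s.1 s.2)
        (CloseWord (d := d) kq ku k₁) ≤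
      pmfExp p fun D => ∑ i, sliceAvg kq (D.scan i) ^ α * sliceAvg ku (D.store i) ^ β := by
  classical
  have hP : ∀ ω : Fin d → Fin 2 × Fin 2, 0 ≤ ∏ i, pairDist wq wu w₁ (ω i).1 (ω i).2 :=
    fun ω => prod_nonneg fun i _ => hw.pairDist_nonneg _ _
  set N : ListOfPoints d m → (Fin d → Fin 2 × Fin 2) → ℝ := fun D ω =>
    ∑ i, nearAvg kq (D.scan i) (wordSet fun i => (ω i).1) *
      nearAvg ku (D.store i) (wordSet fun i => (ω i).2) with hN
  have hN0 : ∀ D ω, 0 ≤ N D ω := fun D ω => sum_nonneg fun i _ =>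
    mul_nonneg (nearAvg_mem_Icc (D.scan_mem i) _).1 (nearAvg_mem_Icc (D.store_mem i) _).1
  calc γ * prodProb (fun s : Fin 2 × Fin 2 => pairDist wq wu w₁ s.1 s.2)
        (CloseWord (d := d) kq ku k₁)
      ≤ ∑ ω : Fin d → Fin 2 × Fin 2, (∏ i, pairDist wq wu w₁ (ω i).1 (ω i).2) *
          pmfExp p fun D => N D ω := by
        rw [prodProb, mul_sum]
        refine le_trans (sum_le_sum fun ω hω => ?_) (sum_le_sum_of_subset_of_nonneg
          (filter_subset _ univ) fun ω _ _ => mul_nonneg (hP ω) ?_)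
        · rw [mul_comm]
          exact mul_le_mul_of_nonneg_left
            (h.le_nearAvg hn hkq hku (mem_filter.1 hω).2) (hP ω)
        · exact sum_nonneg fun D _ => mul_nonneg ENNReal.toReal_nonneg (hN0 D ω)
    _ = pmfExp p fun D => ∑ ω : Fin d → Fin 2 × Fin 2,
          (∏ i, pairDist wq wu w₁ (ω i).1 (ω i).2) * N D ω := by
        rw [pmfExp_sum]
        exact sum_congr rfl fun ω _ => (pmfExp_mul p _ _).symm
    _ ≤ _ := by
        refine pmfExp_mono p fun D => ?_
        simp only [hN, mul_sum]
        rw [sum_comm]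
        exact sum_le_sum fun i _ =>
          sum_pair_le hw hα hβ hkq hku hD (D.scan_mem i) (D.store_mem i)

/-- With `M = 1 + (n - 1) a` the expected cost of scanning a list that stores a point with
probability `a`, and `b` the probability of scanning it. -/
lemma rpow_mul_rpow_le {N a b S T α β : ℝ} (hN : 2 ≤ N) (ha : 0 ≤ a) (hb : 0 ≤ b) (hS : 0 < S)
    (hT : 0 < T) (hα : α ∈ Set.Icc (0 : ℝ) 1) (hβ : β ∈ Set.Icc (0 : ℝ) 1) :
    b ^ α * a ^ β ≤ 2 * N ^ (-β) * (T ^ α * S ^ (1 - α)) *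
      (α / T * (b * (1 + (N - 1) * a)) + (1 - α) / S * (1 + (N - 1) * a)) := by
  have hN0 : 0 < N := by linarith
  have hα1 := sub_nonneg.2 hα.2
  set M := 1 + (N - 1) * a with hM
  have hM0 : 0 < M := by
    have : 0 ≤ (N - 1) * a := mul_nonneg (by linarith) ha
    linarith
  have h1 : a ^ β ≤ 2 * N ^ (-β) * M := by
    have h2 : (N * a) ^ β ≤ 1 + N * a := by
      have hNa : 0 ≤ N * a := by positivity
      rcases le_total (N * a) 1 with h | h
      · exact (Real.rpow_le_one hNa h hβ.1).trans (by linarith)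
      · calc (N * a) ^ β ≤ (N * a) ^ (1 : ℝ) := Real.rpow_le_rpow_of_exponent_le h hβ.2
          _ ≤ _ := by rw [Real.rpow_one]; linarith
    have h3 : 1 + N * a ≤ 2 * M := by rw [hM]; nlinarith
    rw [Real.mul_rpow hN0.le ha] at h2
    have h4 : 0 < N ^ β := Real.rpow_pos_of_pos hN0 _
    rw [Real.rpow_neg hN0.le, mul_assoc, mul_left_comm, inv_mul_eq_div, le_div_iff₀ h4]
    linarith
  have h5 : b ^ α * M = T ^ α * S ^ (1 - α) * ((b * M / T) ^ α * (M / S) ^ (1 - α)) := by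
    have e : M = M ^ α * M ^ (1 - α) := by
      rw [← Real.rpow_add hM0, add_sub_cancel, Real.rpow_one]
    rw [Real.div_rpow (mul_nonneg hb hM0.le) hT.le, Real.div_rpow hM0.le hS.le,
      Real.mul_rpow hb hM0.le]
    have := (Real.rpow_pos_of_pos hT α).ne'
    have := (Real.rpow_pos_of_pos hS (1 - α)).ne'
    field_simp
    rw [mul_assoc, ← e]
  have h6 := Real.geom_mean_le_arith_mean2_weighted hα.1 hα1 (p₁ := b * M / T) (p₂ := M / S)
    (by positivity) (by positivity) (by ring)
  calc b ^ α * a ^ β ≤ b ^ α * (2 * N ^ (-β) * M) := by gcongr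
    _ = 2 * N ^ (-β) * (T ^ α * S ^ (1 - α)) * ((b * M / T) ^ α * (M / S) ^ (1 - α)) := by
        rw [mul_left_comm, h5]; ring
    _ ≤ 2 * N ^ (-β) * (T ^ α * S ^ (1 - α)) * (α * (b * M / T) + (1 - α) * (M / S)) := by
        gcongr
    _ = _ := by ring

lemma pmfExp_sum_rpow_le {α β S T : ℝ} (hn : 2 ≤ n) (h₁ : k₁ ≤ kq) (hu : k₁ ≤ ku)
    (hd : kq + ku ≤ d + k₁) {p : PMF (ListOfPoints d m)} (hS : 0 < S) (hT : 0 < T)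
    (hα : α ∈ Set.Icc (0 : ℝ) 1) (hβ : β ∈ Set.Icc (0 : ℝ) 1)
    (hspace : expectedSpace p n kq ku k₁ ≤ S) (htime : expectedQueryTime p n kq ku k₁ ≤ T) :
    (pmfExp p fun D => ∑ i, sliceAvg kq (D.scan i) ^ α * sliceAvg ku (D.store i) ^ β) ≤
      2 * (n : ℝ) ^ (-β) * (T ^ α * S ^ (1 - α)) := by
  have hn' : (2 : ℝ) ≤ n := by exact_mod_cast hn
  have h1 := (expectedSpace_ge h₁ hu hd hn p).trans hspace
  have h2 := (expectedQueryTime_ge h₁ hu hd hn p).trans htime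
  set Q := 2 * (n : ℝ) ^ (-β) * (T ^ α * S ^ (1 - α)) with hQ
  have hQ0 : 0 ≤ Q := by positivity
  have hα1 := sub_nonneg.2 hα.2
  have h3 : (pmfExp p fun D =>
      ∑ i, sliceAvg kq (D.scan i) ^ α * sliceAvg ku (D.store i) ^ β) ≤
      Q * (α / T * (pmfExp p fun D =>
        ∑ i, sliceAvg kq (D.scan i) * (1 + (n - 1) * sliceAvg ku (D.store i))) +
      (1 - α) / S * (pmfExp p fun D => ∑ i, (1 + (n - 1) * sliceAvg ku (D.store i)))) := by
    rw [← pmfExp_mul, ← pmfExp_mul, ← pmfExp_add, ← pmfExp_mul]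
    refine pmfExp_mono p fun D => ?_
    rw [mul_sum, mul_sum, ← sum_add_distrib, mul_sum]
    exact sum_le_sum fun i _ => rpow_mul_rpow_le hn'
      (sliceAvg_nonneg fun y => (D.store_mem i y).1) (sliceAvg_nonneg fun q => (D.scan_mem i q).1)
      hS hT hα hβ
  have h4 := mul_le_mul_of_nonneg_left h2 (div_nonneg hα.1 hT.le)
  have h5 := mul_le_mul_of_nonneg_left h1 (div_nonneg hα1 hS.le)
  rw [div_mul_cancel₀ _ hT.ne'] at h4
  rw [div_mul_cancel₀ _ hS.ne'] at h5
  calc _ ≤ _ := h3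
    _ ≤ Q * 1 := mul_le_mul_of_nonneg_left (by linarith) hQ0
    _ = Q := mul_one Q

/-- The lower bound in the regime where corrected pairs are close with probability at least `c`. -/
lemma tradeoff_of_closeWord {wq wu w₁ α γ c η ρq ρu : ℝ} (hn : 2 ≤ n) (h₁ : k₁ ≤ kq)
    (hu : k₁ ≤ ku) (hd : kq + ku ≤ d + k₁) {p : PMF (ListOfPoints d m)}
    (hw : GapParams wq wu w₁) (hα : α ∈ Set.Icc (0 : ℝ) 1) (hγ : 0 < γ) (hc : 0 < c)
    (hsucc : SolvesGapSS p n kq ku k₁ γ)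
    (hspace : expectedSpace p n kq ku k₁ ≤ (n : ℝ) ^ (1 + ρu))
    (htime : expectedQueryTime p n kq ku k₁ ≤ (n : ℝ) ^ (ρq - η))
    (hclose : c ≤ prodProb (fun s : Fin 2 × Fin 2 => pairDist wq wu w₁ s.1 s.2)
        (CloseWord (d := d) kq ku k₁)) :
    Real.log (γ * c / 2) ≤
      (α * ρq + (1 - α) * ρu - tradeoffInf α wq wu w₁ - α * η) * Real.log n := by
  have hn0 : (0 : ℝ) < n := by
    have : 0 < n := by omega
    exact_mod_cast this
  have hβ : 1 - α + tradeoffInf α wq wu w₁ ∈ Set.Icc (0 : ℝ) 1 :=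
    ⟨by linarith [hw.tradeoffInf_nonneg hα, hα.2], by linarith [hw.tradeoffInf_le hα]⟩
  have h1 := hsucc.le_sum_rpow (by omega) (by omega) (by omega) hw hα hβ
    fun tq tu T hT => hw.klMatrix_ge hα hT
  have h2 := h1.trans (pmfExp_sum_rpow_le hn h₁ hu hd (Real.rpow_pos_of_pos hn0 _)
    (Real.rpow_pos_of_pos hn0 _) hα hβ hspace htime)
  have h3 : γ * c ≤ _ := (mul_le_mul_of_nonneg_left hclose hγ.le).trans h2
  rw [← Real.rpow_mul hn0.le, ← Real.rpow_mul hn0.le, ← Real.rpow_add hn0, mul_assoc,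
    ← Real.rpow_add hn0] at h3
  have h4 := Real.log_le_log (by positivity) ((div_le_iff₀' two_pos).2 h3)
  rw [Real.log_rpow hn0] at h4
  refine h4.trans_eq ?_
  ring

/-- Neither exponent can be substantially negative. -/
lemma exponents_nonneg {α γ η ρq ρu : ℝ} (hn : 2 ≤ n) (h₁ : k₁ ≤ kq)
    (hu : k₁ ≤ ku) (hd : kq + ku ≤ d + k₁) {p : PMF (ListOfPoints d m)}
    (hα : α ∈ Set.Icc (0 : ℝ) 1) (hγ : 0 < γ)
    (hsucc : SolvesGapSS p n kq ku k₁ γ)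
    (hspace : expectedSpace p n kq ku k₁ ≤ (n : ℝ) ^ (1 + ρu))
    (htime : expectedQueryTime p n kq ku k₁ ≤ (n : ℝ) ^ (ρq - η)) :
    Real.log (γ / 2) ≤ (α * ρq + (1 - α) * ρu - α * η) * Real.log n := by
  have hn' : (2 : ℝ) ≤ n := by exact_mod_cast hn
  have hn0 : (0 : ℝ) < n := by linarith
  have h1 := (expectedSpace_ge h₁ hu hd hn p).trans hspace
  have h2 := (expectedQueryTime_ge h₁ hu hd hn p).trans htime
  have ha : ∀ (D : ListOfPoints d m) i, 0 ≤ sliceAvg ku (D.store i) := fun D i =>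
    sliceAvg_nonneg fun y => (D.store_mem i y).1
  have hb : ∀ (D : ListOfPoints d m) i, 0 ≤ sliceAvg kq (D.scan i) := fun D i =>
    sliceAvg_nonneg fun y => (D.scan_mem i y).1
  have h3 : γ / 2 ≤ (n : ℝ) ^ (ρq - η) := by
    refine le_trans ?_ h2
    refine (half_le_self hγ.le).trans ((hsucc.le_scan (by omega) h₁ hu hd).trans
      (pmfExp_mono p fun D => sum_le_sum fun i _ => le_mul_of_one_le_right (hb D i) ?_))
    have : 0 ≤ ((n : ℝ) - 1) * sliceAvg ku (D.store i) := mul_nonneg (by linarith) (ha D i)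
    linarith
  have h4 : γ / 2 * n ≤ (n : ℝ) ^ (1 + ρu) := by
    refine le_trans ?_ h1
    have h5 := hsucc.le_store (by omega) h₁ hu hd
    calc γ / 2 * n ≤ (n - 1) * γ := by nlinarith
      _ ≤ (n - 1) * pmfExp p fun D => ∑ i, sliceAvg ku (D.store i) :=
          mul_le_mul_of_nonneg_left h5 (by linarith)
      _ ≤ _ := by
          rw [← pmfExp_mul]
          refine pmfExp_mono p fun D => ?_
          rw [mul_sum]
          exact sum_le_sum fun i _ => by linarith
  have h5 := Real.log_le_log (by positivity) h3
  have h6 := Real.log_le_log (by positivity) h4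
  rw [Real.log_rpow hn0] at h5
  rw [Real.log_rpow hn0, Real.log_mul (by positivity) hn0.ne'] at h6
  have h7 := mul_le_mul_of_nonneg_left h5 hα.1
  have h8 := mul_le_mul_of_nonneg_left (show Real.log (γ / 2) ≤ ρu * Real.log n by linarith)
    (sub_nonneg.2 hα.2)
  linarith

end Tradeoff

/-! ### The dichotomy between a trivial trade-off and likely closeness -/

lemma log_two_le_log_one_div {x : ℝ} (hx : 0 < x) (h : x ≤ 1 / 2) :
    Real.log 2 ≤ Real.log (1 / x) := by
  refine Real.log_le_log two_pos ?_
  rw [le_div_iff₀ hx]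
  linarith

lemma convex_log_le {x y u α : ℝ} (hα : α ∈ Set.Icc (0 : ℝ) 1) (hx : 0 < x) (hy : 0 < y)
    (hxu : x ≤ u) (hyu : y ≤ u) : α * Real.log x + (1 - α) * Real.log y ≤ Real.log u := by
  have h1 := mul_le_mul_of_nonneg_left (Real.log_le_log hx hxu) hα.1
  have h2 := mul_le_mul_of_nonneg_left (Real.log_le_log hy hyu) (sub_nonneg.2 hα.2)
  linarith

/-- Either the trade-off infimum is at most `ε`, or corrected pairs are close with probability at
least a constant depending on `ε` only. The test distributions for the infimum are the point
masses at `(1, 1)` and `(0, 0)`. -/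
lemma tradeoffInf_le_or_closeWord {ε : ℝ} (hε : 0 < ε) :
    ∃ c X : ℝ, 0 < c ∧ c ≤ 1 ∧ ∀ (d K A B C : ℕ) (wq wu w₁ α : ℝ), GapParams wq wu w₁ →
      α ∈ Set.Icc (0 : ℝ) 1 → d = K + A + B + C → ((K + A : ℕ) : ℝ) = wq * d →
      ((K + B : ℕ) : ℝ) = wu * d → (K : ℝ) = w₁ * d → 0 < d → X ≤ K →
      tradeoffInf α wq wu w₁ ≤ ε ∨
        c ≤ prodProb (fun s : Fin 2 × Fin 2 => pairDist wq wu w₁ s.1 s.2)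
          (CloseWord (d := d) (K + A) (K + B) K) := by
  have hlog2 : 0 < Real.log 2 := Real.log_pos one_lt_two
  set L := max 1 (1 / (ε * Real.log 2)) with hL
  have hL1 : 1 ≤ L := le_max_left _ _
  have hL0 : 0 < L := by linarith
  have hLε : 1 / L ≤ ε * Real.log 2 := by
    rw [div_le_iff₀ hL0, mul_comm, ← div_le_iff₀ (by positivity)]
    exact le_max_right _ _
  set M := 3600 * (1 + L) with hM
  have hM0 : 0 < M := by positivity
  refine ⟨Real.exp (-(5764400 + 5200 * (1 + L))) / 4,
    M * (1 + L) * Real.exp (Real.log (1 + M) / ε), by positivity, ?_, ?_⟩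
  · have : Real.exp (-(5764400 + 5200 * (1 + L))) ≤ 1 := Real.exp_le_one_iff.2 (by linarith)
    linarith
  intro d K A B C wq wu w₁ α hw hα hd hq hu h1 hd0 hX
  have hdpos : (0 : ℝ) < d := Nat.cast_pos.2 hd0
  have hd' : (d : ℝ) = K + A + B + C := by exact_mod_cast hd
  push_cast at hq hu
  have eA : (A : ℝ) = (wq - w₁) * d := by linarith
  have eB : (B : ℝ) = (wu - w₁) * d := by linarith
  have eC : (C : ℝ) = (1 - wq - wu + w₁) * d := by linarith
  have hKpos : (0 : ℝ) < K := by rw [h1]; exact mul_pos hw.one_pos hdpos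
  have hCpos : (0 : ℝ) < C := by rw [eC]; exact mul_pos hw.none_pos hdpos
  have hKC : A * B ≤ K * C := by
    have : (A : ℝ) * B ≤ K * C := by
      rw [eA, eB, eC, h1]
      have h2 : (wq - w₁) * (wu - w₁) ≤ w₁ * (1 - wq - wu + w₁) := by linarith [hw.mul_lt]
      linarith [mul_le_mul_of_nonneg_right h2 (mul_pos hdpos hdpos).le]
    exact_mod_cast this
  set μ : ℝ := ((max A B : ℕ) : ℝ) with hμ
  have hAμ : (A : ℝ) ≤ μ := Nat.cast_le.2 (le_max_left _ _)
  have hBμ : (B : ℝ) ≤ μ := Nat.cast_le.2 (le_max_right _ _)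
  have hμ0 : 0 ≤ μ := Nat.cast_nonneg _
  have hexp : 1 ≤ Real.exp (Real.log (1 + M) / ε) :=
    Real.one_le_exp (div_nonneg (Real.log_nonneg (by linarith)) hε.le)
  have hKM : M * (1 + L) ≤ K := (le_mul_of_one_le_right (by positivity) hexp).trans hX
  by_cases hlarge : ((min K C : ℕ) : ℝ) ≤ L * μ ∧ M ≤ μ
  · exact Or.inr (prodProb_closeWord hd (Nat.cast_pos.1 hKpos) (Nat.cast_pos.1 hCpos) hKC
      (by push_cast; exact hq) (by push_cast; exact hu) h1 hL1 hlarge.1 hlarge.2)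
  left
  -- `lam * x ≤ y` with `x ≥ x₀` and `y ≤ ε x₀` gives `lam ≤ ε`
  have hfin : ∀ {x x₀ y : ℝ}, tradeoffInf α wq wu w₁ * x ≤ y → x₀ ≤ x → 0 < x₀ → y ≤ ε * x₀ →
      tradeoffInf α wq wu w₁ ≤ ε := by
    intro x x₀ y h hx hx₀ hy
    by_contra hlt
    push Not at hlt
    have h2 : ε * x₀ < tradeoffInf α wq wu w₁ * x := mul_lt_mul hlt hx hx₀ (hε.trans hlt).le
    linarith
  have hsmall : ∀ {Z : ℝ}, 0 < Z → L * μ < Z → Real.log (1 + μ / Z) ≤ ε * Real.log 2 := by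
    intro Z hZ h
    have h2 : μ / Z ≤ 1 / L := by rw [div_le_div_iff₀ hZ hL0]; linarith
    have h3 : 0 ≤ μ / Z := by positivity
    have := Real.log_le_sub_one_of_pos (show 0 < 1 + μ / Z by linarith)
    linarith
  have hratio : ∀ {a z u : ℝ}, 0 < z → (z * d : ℝ) = u → ((a - z) * d : ℝ) ≤ μ →
      a / z ≤ 1 + μ / u := by
    intro a z u hz hu ha
    rw [← hu, div_le_iff₀ hz]
    have e : (1 + μ / (z * d)) * z = z + μ / d := by field_simp
    rw [e, ← sub_le_iff_le_add', le_div_iff₀ hdpos]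
    exact ha
  rcases le_total wu (1 / 2) with hwu | hwu
  · have hKL : L * μ < K := by
      by_contra hcon
      push Not at hcon
      refine hlarge ⟨le_trans (Nat.cast_le.2 (min_le_left _ _)) hcon, ?_⟩
      exact le_of_mul_le_mul_left (show L * M ≤ L * μ by linarith) hL0
    refine hfin (hw.tradeoffInf_mul_le_inter hα) (log_two_le_log_one_div hw.u_pos hwu) hlog2
      ((convex_log_le hα (div_pos hw.q_pos hw.one_pos) (div_pos hw.u_pos hw.one_pos)
        (u := 1 + μ / K) ?_ ?_).trans (hsmall hKpos hKL))
    · exact hratio hw.one_pos h1.symm (by linarith)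
    · exact hratio hw.one_pos h1.symm (by linarith)
  have hq' : 0 < 1 - wq := sub_pos.2 hw.q_lt
  have hu' : 0 < 1 - wu := sub_pos.2 hw.u_lt
  have hub : α * Real.log ((1 - wq) / (1 - wq - wu + w₁)) +
      (1 - α) * Real.log ((1 - wu) / (1 - wq - wu + w₁)) ≤ Real.log (1 + μ / C) :=
    convex_log_le hα (div_pos hq' hw.none_pos) (div_pos hu' hw.none_pos)
      (hratio hw.none_pos eC.symm (by linarith)) (hratio hw.none_pos eC.symm (by linarith))
  by_cases hCL : L * μ < C
  · exact hfin (hw.tradeoffInf_mul_le_none hα)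
      (log_two_le_log_one_div hu' (by linarith)) hlog2 (hub.trans (hsmall hCpos hCL))
  -- now the complements of the stored sets have bounded size in a universe of large size, so that
  -- `log (1 / (1 - w_u))` is large
  push Not at hCL
  have hμM : μ < M := by
    by_contra hcon
    exact hlarge ⟨le_trans (Nat.cast_le.2 (min_le_right _ _)) hCL, not_lt.1 hcon⟩
  have hC1 : (1 : ℝ) ≤ C := by exact_mod_cast Nat.cast_pos.1 hCpos
  have hy : Real.log (1 + μ / C) ≤ Real.log (1 + M) := by
    refine Real.log_le_log (by positivity) ?_
    have := div_le_self hμ0 hC1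
    linarith
  have hx : Real.log (1 + M) / ε ≤ Real.log (1 / (1 - wu)) := by
    rw [Real.le_log_iff_exp_le (by positivity), le_div_iff₀ hu']
    have h2 : (1 - wu) * d ≤ M * (1 + L) := by
      have : L * μ ≤ L * M := mul_le_mul_of_nonneg_left hμM.le hL0.le
      linarith
    have h3 : M * (1 + L) * Real.exp (Real.log (1 + M) / ε) ≤ d := by linarith
    have h4 : (1 - wu) * d * Real.exp (Real.log (1 + M) / ε) ≤ d :=
      (mul_le_mul_of_nonneg_right h2 (Real.exp_pos _).le).trans h3
    have h5 : d * (Real.exp (Real.log (1 + M) / ε) * (1 - wu)) ≤ d * 1 := by linarith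
    exact le_of_mul_le_mul_left h5 hdpos
  refine hfin (hw.tradeoffInf_mul_le_none hα) hx (div_pos (Real.log_pos (by linarith)) hε)
    (hub.trans (hy.trans (le_of_eq ?_)))
  field_simp

/-! ### Letting the number of points grow -/


/-- The sizes of the four cells of a pair of sets, as natural numbers. -/
lemma GapParams.exists_cells {d kq ku k₁ : ℕ} {wq wu w₁ : ℝ} (hw : GapParams wq wu w₁)
    (hd : 0 < d) (hq : (kq : ℝ) = wq * d) (hu : (ku : ℝ) = wu * d) (h1 : (k₁ : ℝ) = w₁ * d) :
    ∃ A B C : ℕ, kq = k₁ + A ∧ ku = k₁ + B ∧ d = k₁ + A + B + C := by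
  have hd' : (0 : ℝ) < d := Nat.cast_pos.2 hd
  have hA : k₁ ≤ kq := by
    have : (k₁ : ℝ) ≤ kq := by rw [hq, h1]; exact mul_le_mul_of_nonneg_right hw.le_q hd'.le
    exact_mod_cast this
  have hB : k₁ ≤ ku := by
    have : (k₁ : ℝ) ≤ ku := by rw [hu, h1]; exact mul_le_mul_of_nonneg_right hw.le_u hd'.le
    exact_mod_cast this
  have hC : kq + ku ≤ d + k₁ := by
    have : (kq : ℝ) + ku ≤ d + k₁ := by
      rw [hq, hu, h1]
      linarith [_root_.mul_pos hw.none_pos hd']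
    exact_mod_cast this
  exact ⟨kq - k₁, ku - k₁, d + k₁ - kq - ku, by omega, by omega, by omega⟩

theorem theorem3
    -- universe size, number of lists, query size, set size, intersection size, as functions of the number of points
    (d m kq ku k₁ : ℕ → ℕ)
    -- the parameters of the problem and the exponents
    (wq wu w₁ ρq ρu : ℕ → ℝ)
    -- the random list-of-points data structure for `n` points
    (p : ∀ n, PMF (ListOfPoints (d n) (m n)))
    (hq : ∀ᶠ n in atTop, (kq n : ℝ) = wq n * d n)
    (hu : ∀ᶠ n in atTop, (ku n : ℝ) = wu n * d n)
    (h1 : ∀ᶠ n in atTop, (k₁ n : ℝ) = w₁ n * d n)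
    (hw : ∀ᶠ n in atTop, wq n ∈ Set.Icc (0 : ℝ) 1 ∧ wu n ∈ Set.Icc (0 : ℝ) 1 ∧
      0 < wq n * wu n ∧ wq n * wu n < w₁ n ∧ w₁ n ≤ min (wq n) (wu n))
    -- `w_q w_u d = ω(log n)`
    (hd : Tendsto (fun n : ℕ => wq n * wu n * d n / Real.log n) atTop atTop)
    (hsucc : ∀ᶠ n in atTop, SolvesGapSS (p n) n (kq n) (ku n) (k₁ n) 0.99)
    (hspace : ∀ᶠ n : ℕ in atTop,
      expectedSpace (p n) n (kq n) (ku n) (k₁ n) ≤ (n : ℝ) ^ (1 + ρu n))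
    (η : ℕ → ℝ) (hη : Tendsto η atTop (𝓝 0))
    (htime : ∀ᶠ n : ℕ in atTop,
      expectedQueryTime (p n) n (kq n) (ku n) (k₁ n) ≤ (n : ℝ) ^ (ρq n - η n)) :
    ∀ α ∈ Set.Icc (0 : ℝ) 1, ∀ ε > 0, ∀ᶠ n in atTop,
      tradeoffInf α (wq n) (wu n) (w₁ n) - ε ≤ α * ρq n + (1 - α) * ρu n := by
  intro α hα ε hε
  obtain ⟨c, X, hc0, hc1, hcX⟩ := tradeoffInf_le_or_closeWord (half_pos hε)
  have hlog : Tendsto (fun n : ℕ => Real.log n) atTop atTop :=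
    Real.tendsto_log_atTop.comp tendsto_natCast_atTop_atTop
  -- the constant factors lost along the way amount to `ε / 4` in the exponent
  have hconst : ∀ᶠ n : ℕ in atTop, -Real.log (0.99 * c / 2) ≤ ε / 4 * Real.log n :=
    (hlog.const_mul_atTop (by positivity)).eventually_ge_atTop _
  have hη' : ∀ᶠ n in atTop, |η n| < ε / 4 := by
    have := hη.abs
    rw [abs_zero] at this
    exact this.eventually_lt_const (by positivity)
  filter_upwards [hq, hu, h1, hw, hsucc, hspace, htime, hconst, hη', eventually_ge_atTop 2,
    hlog.eventually_ge_atTop 1, hd.eventually_ge_atTop (max X 1)]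
    with n hq hu h1 hw hsucc hspace htime hconst hη hn hlogn hdn
  obtain ⟨⟨hq0, hq1⟩, ⟨hu0, hu1⟩, hqu, hlt, hle⟩ := hw
  have hw : GapParams (wq n) (wu n) (w₁ n) :=
    ⟨hq1, hu1, hq0, hu0, hqu, hlt, hle.trans (min_le_left _ _), hle.trans (min_le_right _ _)⟩
  have hlog0 : 0 < Real.log n := by linarith
  have hX : max X 1 ≤ wq n * wu n * d n := by
    rw [le_div_iff₀ hlog0] at hdn
    exact (le_mul_of_one_le_right (by positivity) hlogn).trans hdn
  have hd0 : 0 < d n := by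
    rcases Nat.eq_zero_or_pos (d n) with h | h
    · rw [h, Nat.cast_zero, mul_zero] at hX
      exact absurd ((le_max_right X 1).trans hX) (by norm_num)
    · exact h
  have hXK : X ≤ k₁ n := by
    rw [h1]
    exact (le_max_left _ _).trans (hX.trans
      (mul_le_mul_of_nonneg_right hlt.le (Nat.cast_nonneg _)))
  obtain ⟨A, B, C, eA, eB, eC⟩ := hw.exists_cells hd0 hq hu h1
  have hαη : -(ε / 4) ≤ α * η n := by
    have h2 := neg_le_of_abs_le hη.le
    have h3 := le_of_abs_le hη.le
    nlinarith [hα.1, hα.2]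
  have hfinal : ∀ {v : ℝ}, Real.log (0.99 * c / 2) ≤ v * Real.log n → -(ε / 4) ≤ v := by
    intro v h
    have h2 : -(ε / 4) * Real.log n ≤ v * Real.log n := by linarith
    exact le_of_mul_le_mul_right h2 hlog0
  rcases hcX (d n) (k₁ n) A B C (wq n) (wu n) (w₁ n) α hw hα eC (by rw [← eA, hq])
    (by rw [← eB, hu]) h1 hd0 hXK with h | h
  · have h2 := exponents_nonneg hn (by omega) (by omega) (by omega) hα (by norm_num) hsucc hspace
      htime
    have h3 : Real.log (0.99 * c / 2) ≤ Real.log (0.99 / 2) :=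
      Real.log_le_log (by positivity) (by linarith)
    have h4 := hfinal (h3.trans h2)
    linarith
  · rw [← eA, ← eB] at h
    have h2 := hfinal (tradeoff_of_closeWord hn (by omega) (by omega) (by omega) hw hα
      (by norm_num) hc0 hsucc hspace htime h)
    linarith
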